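/- Let $n\ge 2$, let $B_1$ be the open unit ball of $\mathbb{R}^n$, and let $V:[0,1]\to\mathbb{R}$ be such that $V\ge 0$, $V\not\equiv 0$ and $x\mapsto V(|x|)$ is smooth ($C^\infty$) on $\overline{B_1}$. Let $G(r,s)$, for $r\in[0,1]$ and $s\in(0,1)$, be the Green function of the operator $$\mathcal{L}u=-u''-\frac{n-1}{r}u'+V(r)u \quad\text{on }(0,1),\qquad u'(0)=0,\quad u'(1)=0,$$ that is, $G(\cdot,s)$ is continuous on $[0,1]$, is of class $C^2$ with $\mathcal{L}G(\cdot,s)=0$ on $(0,1)\setminus\{s\}$, satisfies the two boundary conditions, and its derivative in the first variable has one-sided limits at $s$ with $\partial_rG(s^+,s)-\partial_rG(s^-,s)=-1$ (so $\mathcal{L}G(\cdot,s)=\delta_s$). Put $G(r,1)=\lim_{s\to1^-}G(r,s)$ for $r\in[0,1]$. Then this Green function exists, including the limits defining $G(\cdot,1)$, one has $G(r,r)>0$ for $r\in(0,1]$, and with $$F(r)=\frac{|\partial B_1|\,r^{n-1}}{G(r,r)},\qquad r\in(0,1],$$ where $|\partial B_1|$ is the surface measure of the unit sphere, the following hold.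 (i) $\lim_{r\to1^-}F'(r)$ exists and is negative, and $r=1$ is a local minimum point of $F$ on $(0,1]$. (ii) For all sufficiently large real $p$ there is a radial classical solution $u_p\in C^2(\overline{B_1})$ of the Neumann problem $$-\Delta u+V(|x|)u=u^p\ \text{ in }B_1,\qquad u>0\ \text{ in }B_1,\qquad \frac{\partial u}{\partial\nu}=0\ \text{ on }\partial B_1,$$ such that, as $p\to+\infty$, $$u_p(x)\to\frac{G(|x|,1)}{G(1,1)}\quad\text{in }H^1(B_1)\text{ and in }L^\infty(B_1).$$ -/

import Mathlib

open MeasureTheory Filter Topology Set Metric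
open scoped ContDiff ENNReal

/-- The Euclidean space of dimension `n`. -/
abbrev Euc (n : ℕ) : Type := EuclideanSpace ℝ (Fin n)

/-- The Green function `G(r,s)` of `L u = -u'' - (n-1)/r u' + V(r) u` on `(0,1)` with
`u'(0) = 0` and `u'(1) = 0`. For `s ∈ (0,1)` the function `G(·,s)` is continuous on `[0,1]`,
solves `L u = 0` classically away from `s`, has a jump `-1` of its derivative at `s`
(so that `L G(·,s) = δ_s`), and satisfies both boundary conditions.
For `s = 1`, `G(·,1)` is the pointwise limit of `G(·,s)` as `s → 1⁻`. -/
structure IsNeumannGreen (n : ℕ) (V : ℝ → ℝ) (G : ℝ → ℝ → ℝ) : Prop where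
  continuousOn : ∀ s ∈ Ioo (0 : ℝ) 1, ContinuousOn (fun r => G r s) (Icc 0 1)
  contDiffOn : ∀ s ∈ Ioo (0 : ℝ) 1, ContDiffOn ℝ 2 (fun r => G r s) (Ioo 0 1 \ {s})
  equation : ∀ s ∈ Ioo (0 : ℝ) 1, ∀ r ∈ Ioo (0 : ℝ) 1 \ {s},
    -deriv (deriv fun t => G t s) r - ((n : ℝ) - 1) / r * deriv (fun t => G t s) r
      + V r * G r s = 0
  jump : ∀ s ∈ Ioo (0 : ℝ) 1, ∃ a b : ℝ,
    Tendsto (deriv fun t => G t s) (𝓝[<] s) (𝓝 a) ∧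
    Tendsto (deriv fun t => G t s) (𝓝[>] s) (𝓝 b) ∧ b - a = -1
  deriv_zero : ∀ s ∈ Ioo (0 : ℝ) 1, HasDerivWithinAt (fun r => G r s) 0 (Icc 0 1) 0
  deriv_one : ∀ s ∈ Ioo (0 : ℝ) 1, HasDerivWithinAt (fun r => G r s) 0 (Icc 0 1) 1
  tendsto_one : ∀ r ∈ Icc (0 : ℝ) 1, Tendsto (fun s => G r s) (𝓝[<] 1) (𝓝 (G r 1))

/-- `|∂B_1|`, the surface measure of the unit sphere of `ℝⁿ`. -/
noncomputable def sphereArea (n : ℕ) : ℝ :=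
  (Measure.toSphere (volume : Measure (Euc n))).real univ

/-- `F(r) = |∂B_1| r^{n-1} / G(r,r)`. -/
noncomputable def energyF (n : ℕ) (G : ℝ → ℝ → ℝ) (r : ℝ) : ℝ :=
  sphereArea n * r ^ (n - 1) / G r r

/-- `u` is a classical positive solution of `-Δu + V(|x|) u = u^p` in `B_1` with
`∂u/∂ν = 0` on `∂B_1`; at a boundary point `x` the outer normal is `x` itself. -/
structure IsNeumannSolution (n : ℕ) (V : ℝ → ℝ) (p : ℝ) (u : Euc n → ℝ) : Prop where
  contDiffOn : ContDiffOn ℝ 2 u (closedBall 0 1)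
  equation : ∀ x ∈ ball (0 : Euc n) 1,
    -Laplacian.laplacian u x + V ‖x‖ * u x = u x ^ p
  pos : ∀ x ∈ ball (0 : Euc n) 1, 0 < u x
  neumann : ∀ x ∈ sphere (0 : Euc n) 1, fderivWithin ℝ u (closedBall 0 1) x x = 0

/-- `u ∈ H¹(Ω)` with weak gradient `g`. -/
structure HasH1Gradient {n : ℕ} (Ω : Set (Euc n)) (u : Euc n → ℝ) (g : Euc n → Euc n) :
    Prop where
  memLp : MemLp u 2 (volume.restrict Ω)
  memLp_grad : MemLp g 2 (volume.restrict Ω)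
  weak : ∀ φ : Euc n → ℝ, ContDiff ℝ ∞ φ → HasCompactSupport φ → tsupport φ ⊆ Ω →
    ∀ v : Euc n, ∫ x in Ω, u x * fderiv ℝ φ x v = -∫ x in Ω, inner ℝ (g x) v * φ x

/-- `u_i → w` in `H¹(Ω)` along the filter `l`. -/
def TendstoInH1 {n : ℕ} {ι : Type*} (Ω : Set (Euc n)) (l : Filter ι)
    (u : ι → Euc n → ℝ) (w : Euc n → ℝ) : Prop :=
  ∃ (D : ι → Euc n → Euc n) (Dw : Euc n → Euc n),
    HasH1Gradient Ω w Dw ∧ (∀ᶠ i in l, HasH1Gradient Ω (u i) (D i)) ∧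
    Tendsto (fun i => eLpNorm (u i - w) 2 (volume.restrict Ω)) l (𝓝 0) ∧
    Tendsto (fun i => eLpNorm (D i - Dw) 2 (volume.restrict Ω)) l (𝓝 0)

/-- `u_i → w` in `L^∞(Ω)` along the filter `l`. -/
def TendstoInLinfty {n : ℕ} {ι : Type*} (Ω : Set (Euc n)) (l : Filter ι)
    (u : ι → Euc n → ℝ) (w : Euc n → ℝ) : Prop :=
  MemLp w ∞ (volume.restrict Ω) ∧ (∀ᶠ i in l, MemLp (u i) ∞ (volume.restrict Ω)) ∧
    Tendsto (fun i => eLpNorm (u i - w) ∞ (volume.restrict Ω)) l (𝓝 0)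

/-!
Let `φ` solve the linear equation `φ'' + (d / r) φ' = V φ` with `φ'(0) = 0`, `φ(1) = 1`, where
`d = n - 1`; then `φ = G(·, 1) / G(1, 1)`. A shot `u` of the nonlinear equation has nonnegative
Wronskian against `φ`, so `u / φ` decreases and `u ≤ α φ`, with `α` the initial ratio. Just below
`α = 1` the term `u ^ p` is negligible and `u' > 0` near `r = 1`; at a fixed level above `1`, `u'`
cannot stay positive for large `p`. At the first level where `u'` touches zero on a fixed window
`[r₁, 1]`, the energy `(r ^ d u')² / 2 + r ^ (2 d) u ^ (p + 1) / (p + 1)` rules out an interior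
contact point, so `u'(1) = 0`. The mass of `u ^ p` is bounded by the Wronskian and
concentrates at the boundary as `p → ∞`, whence `u → φ`.

With `ψ` a second solution satisfying `ψ'(1) = 0`, obtained by reduction of order and normalised by
`r ^ d (φ' ψ - φ ψ') = 1`, the Green function is `s ^ d φ(min r s) ψ(max r s)`. So
`F = |∂B₁| / (φ ψ)`, and `F'(1) = -|∂B₁| φ'(1)²`.
-/

open scoped NNReal

/-- The weighted radial average `∫₀¹ σ^d h(tσ) dσ`. With `d = n - 1` it is `t⁻ⁿ` times the integral
of `s^(n-1) h(s)` over `[0, t]`, but written so as to be regular at `t = 0`. -/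
noncomputable def radAvg (d : ℕ) (h : ℝ → ℝ) (t : ℝ) : ℝ :=
  ∫ σ in (0 : ℝ)..1, σ ^ d * h (t * σ)

/-- The radial potential of `h`: the solution of `y'' + (d / r) y' = h`, `y(0) = y'(0) = 0`. -/
noncomputable def radPot (d : ℕ) (h : ℝ → ℝ) (r : ℝ) : ℝ :=
  ∫ t in (0 : ℝ)..r, t * radAvg d h t

section RadialCalculus

variable {d : ℕ} {h : ℝ → ℝ}

theorem continuous_radAvg (hh : Continuous h) : Continuous (radAvg d h) :=
  intervalIntegral.continuous_parametric_intervalIntegral_of_continuous'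
    (f := fun t σ => σ ^ d * h (t * σ)) (by fun_prop) 0 1

theorem hasDerivAt_radPot (hh : Continuous h) (t : ℝ) :
    HasDerivAt (radPot d h) (t * radAvg d h t) t := by
  have hc : Continuous fun t => t * radAvg d h t := continuous_id.mul (continuous_radAvg hh)
  exact hc.integral_hasStrictDerivAt 0 t |>.hasDerivAt

theorem continuous_radPot (hh : Continuous h) : Continuous (radPot d h) :=
  continuous_iff_continuousAt.2 fun t => (hasDerivAt_radPot hh t).continuousAt

theorem radPot_zero : radPot d h 0 = 0 :=
  intervalIntegral.integral_same

theorem radAvg_zero : radAvg d h 0 = h 0 / (d + 1) := by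
  simp [radAvg, integral_pow, div_eq_inv_mul]

theorem pow_mul_radAvg (t : ℝ) :
    t ^ (d + 1) * radAvg d h t = ∫ s in (0 : ℝ)..t, s ^ d * h s := by
  have hsubst := intervalIntegral.mul_integral_comp_mul_left (a := 0) (b := 1)
    (f := fun s => s ^ d * h s) t
  rw [mul_zero, mul_one] at hsubst
  rw [← hsubst, radAvg, pow_succ', mul_assoc, ← intervalIntegral.integral_const_mul]
  simp only [mul_pow, mul_assoc]

theorem hasDerivAt_pow_mul_radAvg (hh : Continuous h) (t : ℝ) :
    HasDerivAt (fun t => t ^ (d + 1) * radAvg d h t) (t ^ d * h t) t := by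
  have hc : Continuous fun s => s ^ d * h s := by fun_prop
  simpa only [pow_mul_radAvg] using (hc.integral_hasStrictDerivAt 0 t).hasDerivAt

theorem hasDerivAt_radAvg (hh : Continuous h) {t : ℝ} (ht : t ≠ 0) :
    HasDerivAt (radAvg d h) ((h t - (d + 1) * radAvg d h t) / t) t := by
  have hquot := (hasDerivAt_pow_mul_radAvg (d := d) hh t).div (hasDerivAt_pow (d + 1) t)
    (pow_ne_zero _ ht)
  refine (hquot.congr_of_eventuallyEq ?_).congr_deriv ?_
  · filter_upwards [isOpen_ne.mem_nhds ht] with s hs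
    exact (mul_div_cancel_left₀ _ (pow_ne_zero _ hs)).symm
  · push_cast
    field_simp
    ring

theorem abs_radAvg_le {t M : ℝ} (ht : 0 ≤ t) (hM : ∀ s ∈ Icc 0 t, |h s| ≤ M) :
    |radAvg d h t| ≤ M := by
  have hbound : ∀ σ ∈ uIoc (0 : ℝ) 1, ‖σ ^ d * h (t * σ)‖ ≤ M := by
    intro σ hσ
    rw [uIoc_of_le zero_le_one] at hσ
    rw [norm_mul, norm_pow, Real.norm_of_nonneg hσ.1.le]
    exact (mul_le_of_le_one_left (norm_nonneg _) (pow_le_one₀ hσ.1.le hσ.2)).trans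
      (hM _ ⟨mul_nonneg ht hσ.1.le, mul_le_of_le_one_right ht hσ.2⟩)
  simpa [radAvg] using intervalIntegral.norm_integral_le_of_norm_le_const hbound

theorem radAvg_nonneg {t : ℝ} (ht : 0 ≤ t) (h0 : ∀ s ∈ Icc 0 t, 0 ≤ h s) : 0 ≤ radAvg d h t :=
  intervalIntegral.integral_nonneg zero_le_one fun _ hσ => mul_nonneg (pow_nonneg hσ.1 _)
    (h0 _ ⟨mul_nonneg ht hσ.1, mul_le_of_le_one_right ht hσ.2⟩)

theorem radAvg_one_pos (hh : Continuous h) (h0 : ∀ s ∈ Icc (0 : ℝ) 1, 0 ≤ h s)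
    (hpos : ∃ s ∈ Icc (0 : ℝ) 1, 0 < h s) : 0 < radAvg d h 1 := by
  obtain ⟨s, hs, hhs⟩ := hpos
  rw [← closure_Ioo zero_ne_one] at hs
  obtain ⟨σ, hhσ, hσ⟩ := mem_closure_iff_nhds.1 hs _ (hh.continuousAt.eventually (lt_mem_nhds hhs))
  simp only [radAvg, one_mul]
  exact intervalIntegral.integral_pos zero_lt_one (by fun_prop)
    (fun x hx => mul_nonneg (pow_nonneg hx.1.le _) (h0 x (Ioc_subset_Icc_self hx)))
    ⟨σ, Ioo_subset_Icc_self hσ, mul_pos (pow_pos hσ.1 _) hhσ⟩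

theorem radAvg_sub {h₁ h₂ : ℝ → ℝ} (c₁ : Continuous h₁) (c₂ : Continuous h₂) (t : ℝ) :
    radAvg d (h₁ - h₂) t = radAvg d h₁ t - radAvg d h₂ t := by
  simp only [radAvg, Pi.sub_apply, mul_sub]
  exact intervalIntegral.integral_sub (Continuous.intervalIntegrable (by fun_prop) _ _)
    (Continuous.intervalIntegrable (by fun_prop) _ _)

theorem radPot_sub {h₁ h₂ : ℝ → ℝ} (c₁ : Continuous h₁) (c₂ : Continuous h₂) (t : ℝ) :
    radPot d (h₁ - h₂) t = radPot d h₁ t - radPot d h₂ t := by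
  have e₁ := continuous_radAvg (d := d) c₁
  have e₂ := continuous_radAvg (d := d) c₂
  simp only [radPot, radAvg_sub c₁ c₂, mul_sub]
  exact intervalIntegral.integral_sub (Continuous.intervalIntegrable (by fun_prop) _ _)
    (Continuous.intervalIntegrable (by fun_prop) _ _)

theorem radAvg_const_mul (c t : ℝ) : radAvg d (fun s => c * h s) t = c * radAvg d h t := by
  simp only [radAvg, mul_left_comm _ c, intervalIntegral.integral_const_mul]

theorem radPot_const_mul (c t : ℝ) : radPot d (fun s => c * h s) t = c * radPot d h t := by
  simp only [radPot, radAvg_const_mul, mul_left_comm _ c, intervalIntegral.integral_const_mul]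

theorem integral_mul_exp_le {c M : ℝ} (hc : 0 < c) (hM : 0 ≤ M) (t : ℝ) :
    ∫ s in (0 : ℝ)..t, M * Real.exp (c * s) ≤ M / c * Real.exp (c * t) := by
  rw [intervalIntegral.integral_const_mul, intervalIntegral.integral_comp_mul_left _ hc.ne',
    integral_exp, mul_zero, Real.exp_zero, smul_eq_mul, ← mul_assoc, ← div_eq_mul_inv]
  exact mul_le_mul_of_nonneg_left (sub_le_self _ zero_le_one) (by positivity)

theorem abs_radPot_le_exp {c M t : ℝ} (hc : 0 < c) (ht : t ∈ Icc (0 : ℝ) 1)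
    (hM : ∀ s ∈ Icc (0 : ℝ) 1, |h s| ≤ M * Real.exp (c * s)) :
    |radPot d h t| ≤ M / c * Real.exp (c * t) := by
  have hM0 : 0 ≤ M := by simpa using (abs_nonneg _).trans (hM 0 ⟨le_rfl, zero_le_one⟩)
  have hbound : ∀ s ∈ Ioc 0 t, ‖s * radAvg d h s‖ ≤ M * Real.exp (c * s) := by
    intro s hs
    have hs1 : s ≤ 1 := hs.2.trans ht.2
    have havg : |radAvg d h s| ≤ M * Real.exp (c * s) := by
      refine abs_radAvg_le hs.1.le fun x hx => (hM x ⟨hx.1, hx.2.trans hs1⟩).trans ?_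
      gcongr
      exact hx.2
    rw [norm_mul, Real.norm_of_nonneg hs.1.le]
    exact (mul_le_of_le_one_left (norm_nonneg _) hs1).trans havg
  exact (intervalIntegral.norm_integral_le_of_norm_le ht.1 (Eventually.of_forall hbound)
    (Continuous.intervalIntegrable (by fun_prop) _ _)).trans (integral_mul_exp_le hc hM0 t)

end RadialCalculus

/-- `u'' + (d / r) u' = h` on the line with `u'(0) = 0` and `h` continuous: `x ↦ u ‖x‖` has
Laplacian `x ↦ h ‖x‖` in dimension `d + 1`. The integrated form of the equation is regular at
`r = 0`. -/
structure HasRadialLaplacian (d : ℕ) (u h : ℝ → ℝ) : Prop where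
  continuous_source : Continuous h
  eq_add_radPot : ∀ r, u r = u 0 + radPot d h r

theorem hasRadialLaplacian_add_radPot (d : ℕ) (a : ℝ) {h : ℝ → ℝ} (hh : Continuous h) :
    HasRadialLaplacian d (fun r => a + radPot d h r) h :=
  ⟨hh, fun r => by rw [radPot_zero, add_zero]⟩

namespace HasRadialLaplacian

variable {d : ℕ} {u h : ℝ → ℝ}

theorem hasDerivAt_mul_radAvg (U : HasRadialLaplacian d u h) (r : ℝ) :
    HasDerivAt u (r * radAvg d h r) r :=
  ((hasDerivAt_radPot U.continuous_source r).const_add (u 0)).congr_of_eventuallyEq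
    (Eventually.of_forall U.eq_add_radPot)

theorem deriv_eq (U : HasRadialLaplacian d u h) (r : ℝ) : deriv u r = r * radAvg d h r :=
  (U.hasDerivAt_mul_radAvg r).deriv

theorem hasDerivAt (U : HasRadialLaplacian d u h) (r : ℝ) : HasDerivAt u (deriv u r) r :=
  (U.hasDerivAt_mul_radAvg r).differentiableAt.hasDerivAt

theorem differentiable (U : HasRadialLaplacian d u h) : Differentiable ℝ u :=
  fun r => (U.hasDerivAt r).differentiableAt

theorem continuous (U : HasRadialLaplacian d u h) : Continuous u :=
  U.differentiable.continuous

theorem continuous_deriv (U : HasRadialLaplacian d u h) : Continuous (deriv u) := by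
  rw [funext U.deriv_eq]
  exact continuous_id.mul (continuous_radAvg U.continuous_source)

theorem deriv_zero (U : HasRadialLaplacian d u h) : deriv u 0 = 0 := by
  rw [U.deriv_eq, zero_mul]

theorem hasDerivAt_pow_mul_deriv (U : HasRadialLaplacian d u h) (r : ℝ) :
    HasDerivAt (fun r => r ^ d * deriv u r) (r ^ d * h r) r := by
  simpa only [U.deriv_eq, pow_succ, mul_assoc] using
    hasDerivAt_pow_mul_radAvg (d := d) U.continuous_source r

theorem hasDerivAt_deriv (U : HasRadialLaplacian d u h) {r : ℝ} (hr : r ≠ 0) :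
    HasDerivAt (deriv u) (h r - d / r * deriv u r) r := by
  rw [funext U.deriv_eq]
  refine ((hasDerivAt_id r).mul (hasDerivAt_radAvg U.continuous_source hr)).congr_deriv ?_
  rw [id]
  field_simp
  ring

theorem deriv_nonneg (U : HasRadialLaplacian d u h) (h0 : ∀ r ∈ Icc (0 : ℝ) 1, 0 ≤ h r) {r : ℝ}
    (hr : r ∈ Icc (0 : ℝ) 1) : 0 ≤ deriv u r := by
  rw [U.deriv_eq]
  exact mul_nonneg hr.1 (radAvg_nonneg hr.1 fun s hs => h0 s ⟨hs.1, hs.2.trans hr.2⟩)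

theorem monotoneOn (U : HasRadialLaplacian d u h) {s : Set ℝ} (hs : Convex ℝ s)
    (h0 : ∀ r ∈ s, 0 ≤ deriv u r) : MonotoneOn u s :=
  monotoneOn_of_deriv_nonneg hs U.continuous.continuousOn U.differentiable.differentiableOn
    fun r hr => h0 r (interior_subset hr)

theorem sub_le_mul_sub (U : HasRadialLaplacian d u h) {x y C : ℝ} (hxy : x ≤ y)
    (hC : ∀ s ∈ Icc x y, deriv u s ≤ C) : u y - u x ≤ C * (y - x) :=
  Convex.image_sub_le_mul_sub_of_deriv_le (convex_Icc x y) U.continuous.continuousOn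
    U.differentiable.differentiableOn (fun s hs => hC s (interior_subset hs))
    x ⟨le_rfl, hxy⟩ y ⟨hxy, le_rfl⟩ hxy

theorem mul_sub_le_sub (U : HasRadialLaplacian d u h) {x y C : ℝ} (hxy : x ≤ y)
    (hC : ∀ s ∈ Icc x y, C ≤ deriv u s) : C * (y - x) ≤ u y - u x :=
  Convex.mul_sub_le_image_sub_of_le_deriv (convex_Icc x y) U.continuous.continuousOn
    U.differentiable.differentiableOn (fun s hs => hC s (interior_subset hs))
    x ⟨le_rfl, hxy⟩ y ⟨hxy, le_rfl⟩ hxy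

theorem const_mul (U : HasRadialLaplacian d u h) (c : ℝ) :
    HasRadialLaplacian d (fun r => c * u r) (fun r => c * h r) :=
  ⟨U.continuous_source.const_mul c, fun r => by
    rw [radPot_const_mul, ← mul_add, ← U.eq_add_radPot]⟩

end HasRadialLaplacian

section InitialValueProblem

variable {g : ℝ → ℝ → ℝ} {c : ℝ} {L : ℝ≥0}

/-- The right-hand side `s ↦ g(s, y(s))` along `y(s) = exp(cs) z(s)`, with `z` extended from
`[0, 1]` by constants. For large `c` the weight turns the Picard iteration into a contraction. -/
noncomputable def weightedSource (g : ℝ → ℝ → ℝ) (c : ℝ) (z : C(Icc (0 : ℝ) 1, ℝ)) (s : ℝ) : ℝ :=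
  g s (Real.exp (c * s) * z (projIcc 0 1 zero_le_one s))

theorem continuous_weightedSource (hg : Continuous fun x : ℝ × ℝ => g x.1 x.2)
    (z : C(Icc (0 : ℝ) 1, ℝ)) : Continuous (weightedSource g c z) := by
  have hz : Continuous fun s => z (projIcc (0 : ℝ) 1 zero_le_one s) :=
    z.continuous.comp continuous_projIcc
  exact hg.comp (continuous_id.prodMk (Continuous.mul (by fun_prop) hz))

theorem abs_weightedSource_sub_le (hL : ∀ s ∈ Icc (0 : ℝ) 1, LipschitzWith L (g s))
    (z z' : C(Icc (0 : ℝ) 1, ℝ)) {s : ℝ} (hs : s ∈ Icc (0 : ℝ) 1) :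
    |(weightedSource g c z - weightedSource g c z') s| ≤ L * dist z z' * Real.exp (c * s) := by
  refine ((hL s hs).dist_le_mul _ _).trans ?_
  rw [Real.dist_eq, ← mul_sub, abs_mul, Real.abs_exp, mul_assoc, mul_comm (dist z z')]
  gcongr
  exact ContinuousMap.dist_apply_le_dist (g := z') (f := z) _

/-- The Picard map of `y'' + (d / r) y' = g(r, y)`, `y(0) = a`, `y'(0) = 0`, in the weighted
unknown `z(r) = exp(-cr) y(r)`. -/
noncomputable def weightedPicard (d : ℕ) (c : ℝ) (hg : Continuous fun x : ℝ × ℝ => g x.1 x.2)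
    (a : ℝ) (z : C(Icc (0 : ℝ) 1, ℝ)) : C(Icc (0 : ℝ) 1, ℝ) where
  toFun r := Real.exp (-(c * r)) * (a + radPot d (weightedSource g c z) r)
  continuous_toFun := by
    have := continuous_radPot (d := d) (continuous_weightedSource (c := c) hg z)
    fun_prop

theorem dist_weightedPicard_le (d : ℕ) (hg : Continuous fun x : ℝ × ℝ => g x.1 x.2) (hc : 0 < c)
    (hL : ∀ s ∈ Icc (0 : ℝ) 1, LipschitzWith L (g s)) (a : ℝ) (z z' : C(Icc (0 : ℝ) 1, ℝ)) :
    dist (weightedPicard d c hg a z) (weightedPicard d c hg a z') ≤ L / c * dist z z' := by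
  rw [ContinuousMap.dist_le (by positivity)]
  intro r
  have hpot := abs_radPot_le_exp (d := d) hc r.2 fun s hs => abs_weightedSource_sub_le hL z z' hs
  rw [radPot_sub (continuous_weightedSource hg z) (continuous_weightedSource hg z')] at hpot
  rw [Real.dist_eq, weightedPicard, weightedPicard, ContinuousMap.coe_mk, ContinuousMap.coe_mk,
    ← mul_sub, add_sub_add_left_eq_sub, abs_mul, Real.abs_exp, Real.exp_neg,
    inv_mul_le_iff₀ (Real.exp_pos _)]
  exact hpot.trans_eq (by ring)

theorem dist_weightedPicard_initial_le (d : ℕ) (hg : Continuous fun x : ℝ × ℝ => g x.1 x.2)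
    (hc : 0 < c) (a b : ℝ) (z : C(Icc (0 : ℝ) 1, ℝ)) :
    dist (weightedPicard d c hg a z) (weightedPicard d c hg b z) ≤ dist a b := by
  rw [ContinuousMap.dist_le dist_nonneg]
  intro r
  rw [Real.dist_eq, weightedPicard, weightedPicard, ContinuousMap.coe_mk, ContinuousMap.coe_mk,
    ← mul_sub, add_sub_add_right_eq_sub, abs_mul, Real.abs_exp]
  exact mul_le_of_le_one_left (abs_nonneg _)
    (Real.exp_le_one_iff.2 (neg_nonpos.2 (mul_nonneg hc.le r.2.1)))

theorem apply_eq_of_isFixedPt_weightedPicard {d : ℕ} {a : ℝ} {z : C(Icc (0 : ℝ) 1, ℝ)}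
    {hg : Continuous fun x : ℝ × ℝ => g x.1 x.2} (hz : weightedPicard d c hg a z = z) {r : ℝ}
    (hr : r ∈ Icc (0 : ℝ) 1) :
    weightedSource g c z r = g r (a + radPot d (weightedSource g c z) r) := by
  have hzr : Real.exp (-(c * r)) * (a + radPot d (weightedSource g c z) r) = z ⟨r, hr⟩ :=
    congrArg (fun z : C(Icc (0 : ℝ) 1, ℝ) => z ⟨r, hr⟩) hz
  rw [weightedSource, projIcc_of_mem zero_le_one hr, ← hzr, Real.exp_neg,
    mul_inv_cancel_left₀ (Real.exp_pos _).ne']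

theorem exists_hasRadialLaplacian_family (d : ℕ) (hg : Continuous fun x : ℝ × ℝ => g x.1 x.2)
    (hL : ∀ s ∈ Icc (0 : ℝ) 1, LipschitzWith L (g s)) :
    ∃ u h : ℝ → ℝ → ℝ, (∀ a, HasRadialLaplacian d (u a) (h a)) ∧ (∀ a, u a 0 = a) ∧
      (∀ a, ∀ r ∈ Icc (0 : ℝ) 1, h a r = g r (u a r)) ∧
      ∃ C : ℝ≥0, ∀ r ∈ Icc (0 : ℝ) 1, LipschitzWith C fun a => deriv (u a) r := by
  set c : ℝ := 2 * L + 1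
  have hc : 0 < c := by positivity
  have hcontr : ∀ a, ContractingWith (1 / 2) (weightedPicard d c hg a) := by
    refine fun a => ⟨NNReal.half_lt_self one_ne_zero, LipschitzWith.of_dist_le_mul fun z z' => ?_⟩
    refine (dist_weightedPicard_le d hg hc hL a z z').trans ?_
    gcongr
    rw [div_le_iff₀ hc, NNReal.coe_div, NNReal.coe_one, NNReal.coe_ofNat]
    linarith
  let z : ℝ → C(Icc (0 : ℝ) 1, ℝ) := fun a => (hcontr a).fixedPoint
  have hz : ∀ a, weightedPicard d c hg a (z a) = z a := fun a => (hcontr a).fixedPoint_isFixedPt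
  have hdist : ∀ a b, dist (z a) (z b) ≤ 2 * dist a b := fun a b => by
    refine ((hcontr a).dist_fixedPoint_fixedPoint_of_dist_le' _ (hz a) (hz b)
      (dist_weightedPicard_initial_le d hg hc a b)).trans_eq ?_
    push_cast
    ring
  have hcont : ∀ a, Continuous (weightedSource g c (z a)) := fun a =>
    continuous_weightedSource hg (z a)
  have hu : ∀ a, HasRadialLaplacian d (fun r => a + radPot d (weightedSource g c (z a)) r)
    (weightedSource g c (z a)) := fun a => hasRadialLaplacian_add_radPot d a (hcont a)
  refine ⟨_, _, hu, fun a => by rw [radPot_zero, add_zero],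
    fun a r hr => apply_eq_of_isFixedPt_weightedPicard (hz a) hr,
    ⟨L * 2 * Real.exp c, by positivity⟩, fun r hr => LipschitzWith.of_dist_le_mul fun a b => ?_⟩
  have hsrc : ∀ s ∈ Icc (0 : ℝ) r,
      |(weightedSource g c (z a) - weightedSource g c (z b)) s|
        ≤ L * 2 * Real.exp c * dist a b := by
    intro s hs
    calc _ ≤ L * dist (z a) (z b) * Real.exp (c * s) :=
          abs_weightedSource_sub_le hL _ _ ⟨hs.1, hs.2.trans hr.2⟩
      _ ≤ L * (2 * dist a b) * Real.exp c := by
          gcongr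
          exacts [hdist a b, mul_le_of_le_one_right hc.le (hs.2.trans hr.2)]
      _ = _ := by ring
  rw [Real.dist_eq, (hu a).deriv_eq, (hu b).deriv_eq, ← mul_sub,
    ← radAvg_sub (hcont a) (hcont b), abs_mul, abs_of_nonneg hr.1]
  exact (mul_le_of_le_one_left (abs_nonneg _) hr.2).trans (abs_radAvg_le hr.1 hsrc)

end InitialValueProblem

/-- `φ` is the solution of `φ'' + (d / r) φ' = V φ` on `[0, 1]`, `φ'(0) = 0`, normalised by
`φ(1) = 1`; it will turn out to be `G(·, 1) / G(1, 1)`. The function `k` is a continuous extension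
of `V φ` to the line. -/
structure IsProfile (d : ℕ) (V φ k : ℝ → ℝ) : Prop extends HasRadialLaplacian d φ k where
  source : ∀ r ∈ Icc (0 : ℝ) 1, k r = V r * φ r
  potential_nonneg : ∀ r ∈ Icc (0 : ℝ) 1, 0 ≤ V r
  pos : ∀ r ∈ Icc (0 : ℝ) 1, 0 < φ r
  one : φ 1 = 1
  deriv_one_pos : 0 < deriv φ 1

namespace IsProfile

variable {d : ℕ} {V φ k : ℝ → ℝ} {r : ℝ}

theorem zero_pos (P : IsProfile d V φ k) : 0 < φ 0 := P.pos 0 ⟨le_rfl, zero_le_one⟩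

theorem source_nonneg (P : IsProfile d V φ k) (hr : r ∈ Icc (0 : ℝ) 1) : 0 ≤ k r := by
  rw [P.source r hr]
  exact mul_nonneg (P.potential_nonneg r hr) (P.pos r hr).le

theorem deriv_nonneg (P : IsProfile d V φ k) (hr : r ∈ Icc (0 : ℝ) 1) : 0 ≤ deriv φ r :=
  P.toHasRadialLaplacian.deriv_nonneg (fun _ hs => P.source_nonneg hs) hr

theorem monotoneOn (P : IsProfile d V φ k) : MonotoneOn φ (Icc 0 1) :=
  P.toHasRadialLaplacian.monotoneOn (convex_Icc 0 1) fun _ hr => P.deriv_nonneg hr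

theorem le_one (P : IsProfile d V φ k) (hr : r ∈ Icc (0 : ℝ) 1) : φ r ≤ 1 :=
  P.one ▸ P.monotoneOn hr ⟨zero_le_one, le_rfl⟩ hr.2

theorem zero_le (P : IsProfile d V φ k) (hr : r ∈ Icc (0 : ℝ) 1) : φ 0 ≤ φ r :=
  P.monotoneOn ⟨le_rfl, zero_le_one⟩ hr hr.1

theorem exists_deriv_le (P : IsProfile d V φ k) :
    ∃ B, 0 ≤ B ∧ ∀ r ∈ Icc (0 : ℝ) 1, deriv φ r ≤ B := by
  obtain ⟨B, hB⟩ := isCompact_Icc.exists_bound_of_continuousOn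
    (P.continuous_deriv.continuousOn (s := Icc (0 : ℝ) 1))
  exact ⟨B, (norm_nonneg _).trans (hB 0 ⟨le_rfl, zero_le_one⟩),
    fun r hr => (le_abs_self _).trans (hB r hr)⟩

end IsProfile

theorem continuous_comp_projIcc {V : ℝ → ℝ} (hV : ContinuousOn V (Icc 0 1)) :
    Continuous fun r => V (projIcc (0 : ℝ) 1 zero_le_one r) :=
  hV.comp_continuous (continuous_subtype_val.comp continuous_projIcc) fun _ => Subtype.coe_prop _

theorem lipschitzWith_const_mul {c : ℝ} {L : ℝ≥0} (hc : ‖c‖ ≤ L) :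
    LipschitzWith L fun x : ℝ => c * x :=
  LipschitzWith.of_dist_le_mul fun x y => by
    rw [Real.dist_eq, ← mul_sub, abs_mul]
    exact mul_le_mul_of_nonneg_right hc (abs_nonneg _)

theorem exists_nnnorm_bound_of_continuousOn {V : ℝ → ℝ} (hV : ContinuousOn V (Icc 0 1)) :
    ∃ L : ℝ≥0, ∀ r ∈ Icc (0 : ℝ) 1, ‖V r‖ ≤ L := by
  obtain ⟨L, hL⟩ := isCompact_Icc.exists_bound_of_continuousOn hV
  exact ⟨L.toNNReal, fun r hr => (hL r hr).trans (Real.le_coe_toNNReal L)⟩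

theorem exists_hasRadialLaplacian_one_le (d : ℕ) {V : ℝ → ℝ} (hV : ContinuousOn V (Icc 0 1))
    (h0 : ∀ r ∈ Icc (0 : ℝ) 1, 0 ≤ V r) :
    ∃ y k, HasRadialLaplacian d y k ∧ (∀ r ∈ Icc (0 : ℝ) 1, 1 ≤ y r) ∧
      ∀ r ∈ Icc (0 : ℝ) 1, k r = V r * y r := by
  obtain ⟨L, hL⟩ := exists_nnnorm_bound_of_continuousOn hV
  have hVc := continuous_comp_projIcc hV
  -- Solving with `V y₊` in place of `V y` makes the source nonnegative beforehand.
  obtain ⟨u, h, hu, hu0, heq, -⟩ := exists_hasRadialLaplacian_family d (L := L)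
    (g := fun s x => V (projIcc (0 : ℝ) 1 zero_le_one s) * max x 0)
    ((hVc.comp continuous_fst).mul (continuous_snd.max continuous_const)) (by
      intro s hs
      rw [projIcc_of_mem zero_le_one hs]
      simpa only [mul_one, Function.comp_def, id] using
        (lipschitzWith_const_mul (hL s hs)).comp (LipschitzWith.id.max_const (0 : ℝ)))
  have hsrc : ∀ r ∈ Icc (0 : ℝ) 1, h 1 r = V r * max (u 1 r) 0 := fun r hr => by
    rw [heq 1 r hr, projIcc_of_mem zero_le_one hr]
  have hmono : MonotoneOn (u 1) (Icc 0 1) := (hu 1).monotoneOn (convex_Icc 0 1) fun _ =>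
    (hu 1).deriv_nonneg fun r hr => hsrc r hr ▸ mul_nonneg (h0 r hr) (le_max_right _ _)
  have hone : ∀ r ∈ Icc (0 : ℝ) 1, 1 ≤ u 1 r := fun r hr =>
    (hu0 1).ge.trans (hmono ⟨le_rfl, zero_le_one⟩ hr hr.1)
  exact ⟨u 1, h 1, hu 1, hone, fun r hr => by
    rw [hsrc r hr, max_eq_left (zero_le_one.trans (hone r hr))]⟩

theorem exists_isProfile (d : ℕ) {V : ℝ → ℝ} (hV : ContinuousOn V (Icc 0 1))
    (h0 : ∀ r ∈ Icc (0 : ℝ) 1, 0 ≤ V r) (hne : ∃ r ∈ Icc (0 : ℝ) 1, V r ≠ 0) :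
    ∃ φ k, IsProfile d V φ k := by
  obtain ⟨y, k, hy, hone, hk⟩ := exists_hasRadialLaplacian_one_le d hV h0
  have hpos : ∀ r ∈ Icc (0 : ℝ) 1, 0 < y r := fun r hr => zero_lt_one.trans_le (hone r hr)
  have hy1 : 0 < y 1 := hpos 1 ⟨zero_le_one, le_rfl⟩
  refine ⟨fun r => (y 1)⁻¹ * y r, fun r => (y 1)⁻¹ * k r, hy.const_mul _,
    fun r hr => by rw [hk r hr, mul_left_comm], h0,
    fun r hr => mul_pos (inv_pos.2 hy1) (hpos r hr), inv_mul_cancel₀ hy1.ne', ?_⟩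
  rw [(hy.const_mul _).deriv_eq, one_mul, radAvg_const_mul]
  refine mul_pos (inv_pos.2 hy1) (radAvg_one_pos hy.continuous_source
    (fun r hr => hk r hr ▸ mul_nonneg (h0 r hr) (hpos r hr).le) ?_)
  obtain ⟨r, hr, hVr⟩ := hne
  exact ⟨r, hr, hk r hr ▸ mul_pos ((h0 r hr).lt_of_ne' hVr) (hpos r hr)⟩

/-- The power `x ↦ x₊ ^ p` truncated at the level `2`, a bounded Lipschitz substitute for `x ^ p`
that agrees with it on `[0, 2]`. -/
noncomputable def truncPow (p x : ℝ) : ℝ := (projIcc (0 : ℝ) 2 zero_le_two x : ℝ) ^ p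

section TruncPow

variable {p x y : ℝ}

theorem truncPow_nonneg (p x : ℝ) : 0 ≤ truncPow p x :=
  Real.rpow_nonneg (projIcc (0 : ℝ) 2 zero_le_two x).2.1 _

theorem truncPow_of_mem (hx : x ∈ Icc (0 : ℝ) 2) : truncPow p x = x ^ p := by
  rw [truncPow, projIcc_of_mem zero_le_two hx]

theorem monotone_truncPow (hp : 0 ≤ p) : Monotone (truncPow p) := fun x _ hxy =>
  Real.rpow_le_rpow (projIcc (0 : ℝ) 2 zero_le_two x).2.1 (monotone_projIcc zero_le_two hxy) hp

theorem truncPow_le_rpow (hp : 0 ≤ p) (hxy : x ≤ y) (hy : 0 ≤ y) : truncPow p x ≤ y ^ p :=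
  Real.rpow_le_rpow (projIcc (0 : ℝ) 2 zero_le_two x).2.1
    ((coe_projIcc (0 : ℝ) 2 zero_le_two x).trans_le
      (max_le hy ((min_le_right _ _).trans hxy))) hp

theorem continuous_truncPow (hp : 0 ≤ p) : Continuous (truncPow p) :=
  (continuous_subtype_val.comp continuous_projIcc).rpow_const fun _ => Or.inr hp

theorem exists_lipschitzWith_truncPow (hp : 1 ≤ p) : ∃ L, LipschitzWith L (truncPow p) := by
  have hsmooth : ContDiff ℝ 1 fun x : ℝ => x ^ p :=
    Real.contDiff_rpow_const_of_le (n := 1) (by exact_mod_cast hp)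
  obtain ⟨L, hL⟩ := (hsmooth.locallyLipschitz.locallyLipschitzOn (s := Icc 0 2))
    |>.exists_lipschitzOnWith_of_compact isCompact_Icc
  exact ⟨L * 1, hL.to_restrict.comp (LipschitzWith.projIcc zero_le_two)⟩

end TruncPow

/-- The flux `r ^ d (u φ' - u' φ)`, that is, the Wronskian of `u` and `φ` with the weight for which
Lagrange's identity has no first-order terms. -/
noncomputable def radWronskian (d : ℕ) (φ u : ℝ → ℝ) (r : ℝ) : ℝ :=
  r ^ d * (u r * deriv φ r - deriv u r * φ r)

namespace HasRadialLaplacian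

variable {d : ℕ} {φ k u h : ℝ → ℝ}

theorem hasDerivAt_radWronskian (Φ : HasRadialLaplacian d φ k) (U : HasRadialLaplacian d u h)
    (r : ℝ) : HasDerivAt (radWronskian d φ u) (r ^ d * (u r * k r - h r * φ r)) r := by
  refine (((U.hasDerivAt r).mul (Φ.hasDerivAt_pow_mul_deriv r)).sub
    ((U.hasDerivAt_pow_mul_deriv r).mul (Φ.hasDerivAt r))).congr_deriv ?_
    |>.congr_of_eventuallyEq (Eventually.of_forall fun s => ?_)
  · ring
  · simp only [radWronskian, Pi.sub_apply, Pi.mul_apply]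
    ring

theorem radWronskian_zero (Φ : HasRadialLaplacian d φ k) (U : HasRadialLaplacian d u h) :
    radWronskian d φ u 0 = 0 := by
  rw [radWronskian, Φ.deriv_zero, U.deriv_zero, mul_zero, zero_mul, sub_zero, mul_zero]

end HasRadialLaplacian

/-- A shot from the level `α`: `u` solves `u'' + (d / r) u' = V u - u₊ ^ p` (with the power
truncated) on `[0, 1]` with `u(0) = α φ(0)`, `u'(0) = 0`. The function `h` is a continuous
extension of the right-hand side. -/
structure IsShot (d : ℕ) (V φ : ℝ → ℝ) (p α : ℝ) (u h : ℝ → ℝ) : Prop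
    extends HasRadialLaplacian d u h where
  zero : u 0 = α * φ 0
  source : ∀ r ∈ Icc (0 : ℝ) 1, h r = V r * u r - truncPow p (u r)

theorem exists_isShot_family (d : ℕ) {V : ℝ → ℝ} (φ : ℝ → ℝ) (hV : ContinuousOn V (Icc 0 1))
    {p : ℝ} (hp : 1 ≤ p) :
    ∃ u h : ℝ → ℝ → ℝ, (∀ α, IsShot d V φ p α (u α) (h α)) ∧
      ∃ C : ℝ≥0, ∀ r ∈ Icc (0 : ℝ) 1, LipschitzWith C fun α => deriv (u α) r := by
  obtain ⟨L, hL⟩ := exists_nnnorm_bound_of_continuousOn hV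
  obtain ⟨L', hL'⟩ := exists_lipschitzWith_truncPow hp
  have hVc := continuous_comp_projIcc hV
  obtain ⟨u, h, hu, hu0, heq, C, hC⟩ := exists_hasRadialLaplacian_family d (L := L + L')
    (g := fun s x => V (projIcc (0 : ℝ) 1 zero_le_one s) * x - truncPow p x)
    (((hVc.comp continuous_fst).mul continuous_snd).sub
      ((continuous_truncPow (zero_le_one.trans hp)).comp continuous_snd)) (by
      intro s hs
      rw [projIcc_of_mem zero_le_one hs]
      exact (lipschitzWith_const_mul (hL s hs)).sub hL')
  refine ⟨fun α => u (α * φ 0), fun α => h (α * φ 0), fun α =>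
    ⟨hu _, hu0 _, fun r hr => ?_⟩, C * ‖φ 0‖₊, fun r hr => (hC r hr).comp ?_⟩
  · simpa only [projIcc_of_mem zero_le_one hr] using heq (α * φ 0) r hr
  · simpa only [mul_comm _ (φ 0)] using lipschitzWith_const_mul (coe_nnnorm (φ 0)).ge

namespace IsShot

variable {d : ℕ} {V φ k u h : ℝ → ℝ} {p α r R M : ℝ}

theorem hasDerivAt_radWronskian (S : IsShot d V φ p α u h) (P : IsProfile d V φ k)
    (hr : r ∈ Icc (0 : ℝ) 1) :
    HasDerivAt (radWronskian d φ u) (r ^ d * (φ r * truncPow p (u r))) r := by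
  refine (P.toHasRadialLaplacian.hasDerivAt_radWronskian S.toHasRadialLaplacian r).congr_deriv ?_
  rw [P.source r hr, S.source r hr]
  ring

theorem radWronskian_monotoneOn (S : IsShot d V φ p α u h) (P : IsProfile d V φ k) :
    MonotoneOn (radWronskian d φ u) (Icc 0 1) :=
  monotoneOn_of_hasDerivWithinAt_nonneg (convex_Icc 0 1)
    (fun _ hr => (S.hasDerivAt_radWronskian P hr).continuousAt.continuousWithinAt)
    (fun _ hr => (S.hasDerivAt_radWronskian P (interior_subset hr)).hasDerivWithinAt)
    fun r hr => mul_nonneg (pow_nonneg (interior_subset hr).1 _)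
      (mul_nonneg (P.pos r (interior_subset hr)).le (truncPow_nonneg _ _))

theorem radWronskian_nonneg (S : IsShot d V φ p α u h) (P : IsProfile d V φ k)
    (hr : r ∈ Icc (0 : ℝ) 1) : 0 ≤ radWronskian d φ u r :=
  P.toHasRadialLaplacian.radWronskian_zero S.toHasRadialLaplacian ▸
    S.radWronskian_monotoneOn P ⟨le_rfl, zero_le_one⟩ hr hr.1

theorem radWronskian_le (S : IsShot d V φ p α u h) (P : IsProfile d V φ k)
    (hR : R ∈ Icc (0 : ℝ) 1) (hM : ∀ s ∈ Icc 0 R, truncPow p (u s) ≤ M) :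
    radWronskian d φ u R ≤ R ^ d * φ R * M := by
  have hsub : Icc 0 R ⊆ Icc (0 : ℝ) 1 := Icc_subset_Icc_right hR.2
  have hderiv : ∀ x ∈ interior (Icc 0 R), deriv (radWronskian d φ u) x ≤ R ^ d * (φ R * M) := by
    intro x hx
    have hx' : x ∈ Icc 0 R := interior_subset hx
    rw [(S.hasDerivAt_radWronskian P (hsub hx')).deriv]
    have hφ : φ x ≤ φ R := P.monotoneOn (hsub hx') hR hx'.2
    have hφx := P.pos x (hsub hx')
    have hpow := truncPow_nonneg p (u x)
    gcongr
    exacts [pow_nonneg hR.1 d, hx'.1, hx'.2, (P.pos R hR).le, hM x hx']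
  have hmvt := Convex.image_sub_le_mul_sub_of_deriv_le (convex_Icc 0 R)
    (fun x hx => (S.hasDerivAt_radWronskian P (hsub hx)).continuousAt.continuousWithinAt)
    (fun x hx => (S.hasDerivAt_radWronskian P
      (hsub (interior_subset hx))).differentiableAt.differentiableWithinAt)
    hderiv 0 ⟨le_rfl, hR.1⟩ R ⟨hR.1, le_rfl⟩ hR.1
  rw [P.toHasRadialLaplacian.radWronskian_zero S.toHasRadialLaplacian, sub_zero, sub_zero,
    ← mul_assoc (R ^ d)] at hmvt
  exact hmvt.trans (mul_le_of_le_one_right (mul_nonneg (mul_nonneg (pow_nonneg hR.1 d)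
    (P.pos R hR).le) ((truncPow_nonneg _ _).trans (hM 0 ⟨le_rfl, hR.1⟩))) hR.2)

theorem radWronskian_div_le (S : IsShot d V φ p α u h) (P : IsProfile d V φ k)
    (hR : R ∈ Ioc (0 : ℝ) 1) (hM : ∀ s ∈ Icc 0 R, truncPow p (u s) ≤ M) :
    radWronskian d φ u R / (R ^ d * φ R) ≤ M :=
  (div_le_iff₀' (mul_pos (pow_pos hR.1 d) (P.pos R (Ioc_subset_Icc_self hR)))).2
    (S.radWronskian_le P (Ioc_subset_Icc_self hR) hM)

theorem deriv_eq_ratio (S : IsShot d V φ p α u h) (P : IsProfile d V φ k)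
    (hr : r ∈ Icc (0 : ℝ) 1) :
    deriv u r = u r / φ r * deriv φ r - radWronskian d φ u r / (r ^ d * φ r) := by
  rcases hr.1.eq_or_lt with rfl | hr0
  · rw [P.toHasRadialLaplacian.radWronskian_zero S.toHasRadialLaplacian, P.deriv_zero,
      S.deriv_zero, mul_zero, zero_div, sub_zero]
  · have hφ := (P.pos r hr).ne'
    rw [radWronskian]
    field_simp
    ring

theorem deriv_le_ratio (S : IsShot d V φ p α u h) (P : IsProfile d V φ k)
    (hr : r ∈ Icc (0 : ℝ) 1) : deriv u r ≤ u r / φ r * deriv φ r := by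
  rw [S.deriv_eq_ratio P hr]
  exact sub_le_self _ (div_nonneg (S.radWronskian_nonneg P hr)
    (mul_nonneg (pow_nonneg hr.1 d) (P.pos r hr).le))

theorem hasDerivAt_ratio (S : IsShot d V φ p α u h) (P : IsProfile d V φ k)
    (hr : r ∈ Ioc (0 : ℝ) 1) :
    HasDerivAt (fun r => u r / φ r) (-(radWronskian d φ u r / (r ^ d * φ r)) / φ r) r := by
  have hφ := (P.pos r (Ioc_subset_Icc_self hr)).ne'
  refine ((S.hasDerivAt r).div (P.hasDerivAt r) hφ).congr_deriv ?_
  rw [S.deriv_eq_ratio P (Ioc_subset_Icc_self hr)]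
  field_simp
  ring

theorem continuousOn_ratio (S : IsShot d V φ p α u h) (P : IsProfile d V φ k) :
    ContinuousOn (fun r => u r / φ r) (Icc 0 1) :=
  S.continuous.continuousOn.div P.continuous.continuousOn fun r hr => (P.pos r hr).ne'

theorem ratio_antitoneOn (S : IsShot d V φ p α u h) (P : IsProfile d V φ k) :
    AntitoneOn (fun r => u r / φ r) (Icc 0 1) := by
  refine antitoneOn_of_hasDerivWithinAt_nonpos (convex_Icc 0 1) (S.continuousOn_ratio P)
    (fun r hr => (S.hasDerivAt_ratio P ?_).hasDerivWithinAt) fun r hr => ?_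
  · exact Ioo_subset_Ioc_self (interior_Icc (a := (0 : ℝ)) ▸ hr)
  · have hr' : r ∈ Icc (0 : ℝ) 1 := interior_subset hr
    exact div_nonpos_of_nonpos_of_nonneg (neg_nonpos.2 (div_nonneg (S.radWronskian_nonneg P hr')
      (mul_nonneg (pow_nonneg hr'.1 d) (P.pos r hr').le))) (P.pos r hr').le

theorem ratio_zero (S : IsShot d V φ p α u h) (P : IsProfile d V φ k) : u 0 / φ 0 = α := by
  rw [S.zero, mul_div_cancel_right₀ _ P.zero_pos.ne']

theorem ratio_le (S : IsShot d V φ p α u h) (P : IsProfile d V φ k) (hr : r ∈ Icc (0 : ℝ) 1) :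
    u r / φ r ≤ α :=
  (S.ratio_antitoneOn P ⟨le_rfl, zero_le_one⟩ hr hr.1).trans_eq (S.ratio_zero P)

theorem le_mul (S : IsShot d V φ p α u h) (P : IsProfile d V φ k) (hr : r ∈ Icc (0 : ℝ) 1) :
    u r ≤ α * φ r :=
  (div_le_iff₀ (P.pos r hr)).1 (S.ratio_le P hr)

theorem le_level (S : IsShot d V φ p α u h) (P : IsProfile d V φ k) (hα : 0 ≤ α)
    (hr : r ∈ Icc (0 : ℝ) 1) : u r ≤ α :=
  (S.le_mul P hr).trans (mul_le_of_le_one_right hα (P.le_one hr))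

theorem sub_le_ratio (S : IsShot d V φ p α u h) (P : IsProfile d V φ k)
    (hR : R ∈ Icc (0 : ℝ) 1) (hM : ∀ s ∈ Icc 0 R, truncPow p (u s) ≤ M) :
    α - M / φ 0 ≤ u R / φ R := by
  have hM0 : 0 ≤ M := (truncPow_nonneg _ _).trans (hM 0 ⟨le_rfl, hR.1⟩)
  have hIoc : interior (Icc 0 R) ⊆ Ioc (0 : ℝ) 1 := by
    rw [interior_Icc]
    exact fun x hx => ⟨hx.1, hx.2.le.trans hR.2⟩
  have hderiv : ∀ x ∈ interior (Icc 0 R), -(M / φ 0) ≤ deriv (fun r => u r / φ r) x := by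
    intro x hx
    have hx1 := Ioc_subset_Icc_self (hIoc hx)
    rw [(S.hasDerivAt_ratio P (hIoc hx)).deriv, neg_div, neg_le_neg_iff]
    exact div_le_div₀ hM0 (S.radWronskian_div_le P (hIoc hx) fun s hs =>
      hM s ⟨hs.1, hs.2.trans (interior_subset hx).2⟩) P.zero_pos (P.zero_le hx1)
  have hmvt := Convex.mul_sub_le_image_sub_of_le_deriv (convex_Icc 0 R)
    ((S.continuousOn_ratio P).mono (Icc_subset_Icc_right hR.2))
    (fun x hx => (S.hasDerivAt_ratio P (hIoc hx)).differentiableAt.differentiableWithinAt)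
    hderiv 0 ⟨le_rfl, hR.1⟩ R ⟨hR.1, le_rfl⟩ hR.1
  rw [S.ratio_zero P, sub_zero] at hmvt
  have hMR : M / φ 0 * R ≤ M / φ 0 :=
    mul_le_of_le_one_right (div_nonneg hM0 P.zero_pos.le) hR.2
  linarith

end IsShot

/-- A window `[r₁, 1]` on which `φ' ≥ φ'(1) / 2`, and a range of levels `α ≤ a` that contains a
neighbourhood of `1` but for which `α φ < 1` on `[0, r₁]`, so that large powers of a shot are
negligible outside the window. -/
structure ShootingWindow (d : ℕ) (V φ k : ℝ → ℝ) (r₁ a : ℝ) : Prop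
    extends IsProfile d V φ k where
  left_pos : 0 < r₁
  left_lt_one : r₁ < 1
  slope : ∀ r ∈ Icc r₁ 1, deriv φ 1 / 2 ≤ deriv φ r
  one_lt_level : 1 < a
  level_le_two : a ≤ 2
  level_mul_lt_one : a * φ r₁ < 1

theorem IsProfile.exists_shootingWindow {d : ℕ} {V φ k : ℝ → ℝ} (P : IsProfile d V φ k) :
    ∃ r₁ a, ShootingWindow d V φ k r₁ a := by
  obtain ⟨δ, hδ, hslope⟩ := Metric.eventually_nhds_iff.1
    (P.continuous_deriv.continuousAt.eventually (lt_mem_nhds (half_lt_self P.deriv_one_pos)))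
  set r₁ : ℝ := max (1 / 2) (1 - δ / 2)
  have hr₁ : r₁ < 1 := max_lt (by norm_num) (by linarith)
  have hr₁pos : 0 < r₁ := lt_max_of_lt_left (by norm_num)
  have hslope' : ∀ r ∈ Icc r₁ 1, deriv φ 1 / 2 ≤ deriv φ r := fun r hr => by
    refine (hslope ?_).le
    have : 1 - δ / 2 ≤ r := (le_max_right _ _).trans hr.1
    rw [Real.dist_eq, abs_of_nonpos (by linarith [hr.2])]
    linarith
  have hmvt := P.mul_sub_le_sub hr₁.le hslope'
  have hφlt : φ r₁ < 1 := by
    have := mul_pos (half_pos P.deriv_one_pos) (sub_pos.2 hr₁)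
    linarith [P.one]
  have hφpos : 0 < φ r₁ := P.pos r₁ ⟨hr₁pos.le, hr₁.le⟩
  exact ⟨r₁, 1 + (1 - φ r₁) / 2, P, hr₁pos, hr₁, hslope', by linarith, by linarith, by nlinarith⟩

namespace ShootingWindow

variable {d : ℕ} {V φ k : ℝ → ℝ} {r₁ a r : ℝ}

theorem mem_unit (w : ShootingWindow d V φ k r₁ a) (hr : r ∈ Icc r₁ 1) : r ∈ Icc (0 : ℝ) 1 :=
  ⟨w.left_pos.le.trans hr.1, hr.2⟩

theorem left_mem (w : ShootingWindow d V φ k r₁ a) : r₁ ∈ Icc r₁ 1 := ⟨le_rfl, w.left_lt_one.le⟩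

theorem right_mem (w : ShootingWindow d V φ k r₁ a) : (1 : ℝ) ∈ Icc r₁ 1 :=
  ⟨w.left_lt_one.le, le_rfl⟩

theorem level_mul_nonneg (w : ShootingWindow d V φ k r₁ a) : 0 ≤ a * φ r₁ :=
  mul_nonneg (zero_le_one.trans w.one_lt_level.le) (w.pos r₁ (w.mem_unit w.left_mem)).le

end ShootingWindow

/-- The lower bound `r₁^d φ'(1) / 16` for the weighted slope with which shots enter the window. -/
noncomputable def entrySlope (d : ℕ) (φ : ℝ → ℝ) (r₁ : ℝ) : ℝ := r₁ ^ d * (deriv φ 1 / 16)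

theorem ShootingWindow.entrySlope_pos {d : ℕ} {V φ k : ℝ → ℝ} {r₁ a : ℝ}
    (w : ShootingWindow d V φ k r₁ a) : 0 < entrySlope d φ r₁ :=
  mul_pos (pow_pos w.left_pos d) (div_pos w.deriv_one_pos (by norm_num))

theorem eventually_rpow_le {θ ε : ℝ} (h0 : 0 ≤ θ) (h1 : θ < 1) (hε : 0 < ε) :
    ∀ᶠ p : ℝ in atTop, θ ^ p ≤ ε :=
  (tendsto_rpow_atTop_of_base_lt_one θ (by linarith) h1).eventually (ge_mem_nhds hε)

namespace IsShot

variable {d : ℕ} {V φ k u h : ℝ → ℝ} {p α r₁ a R M r : ℝ}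

theorem one_fourth_le_ratio (S : IsShot d V φ p α u h) (P : IsProfile d V φ k) (hα : 1 / 2 ≤ α)
    (hR : R ∈ Icc (0 : ℝ) 1) (hM₀ : M ≤ φ 0 / 4) (hM : ∀ s ∈ Icc 0 R, truncPow p (u s) ≤ M) :
    1 / 4 ≤ u R / φ R := by
  have := (div_le_iff₀ P.zero_pos).2 (show M ≤ 1 / 4 * φ 0 by linarith)
  linarith [S.sub_le_ratio P hR hM]

theorem le_deriv_of_truncPow_le (S : IsShot d V φ p α u h) (w : ShootingWindow d V φ k r₁ a)
    (hα : 1 / 2 ≤ α) (hR : R ∈ Icc r₁ 1) (hM₀ : M ≤ φ 0 / 4) (hM₁ : M ≤ deriv φ 1 / 16)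
    (hM : ∀ s ∈ Icc 0 R, truncPow p (u s) ≤ M) : deriv φ 1 / 16 ≤ deriv u R := by
  have hR' := w.mem_unit hR
  have hratio := S.one_fourth_le_ratio w.toIsProfile hα hR' hM₀ hM
  have hflux := S.radWronskian_div_le w.toIsProfile ⟨w.left_pos.trans_le hR.1, hR.2⟩ hM
  have hmul : 1 / 4 * (deriv φ 1 / 2) ≤ u R / φ R * deriv φ R :=
    mul_le_mul hratio (w.slope R hR) (half_pos w.deriv_one_pos).le
      ((by norm_num : (0 : ℝ) ≤ 1 / 4).trans hratio)
  rw [S.deriv_eq_ratio w.toIsProfile hR']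
  linarith

theorem truncPow_le_left (S : IsShot d V φ p α u h) (w : ShootingWindow d V φ k r₁ a)
    (hp : 0 ≤ p) (hα : α ≤ a) (hr : r ∈ Icc 0 r₁) : truncPow p (u r) ≤ (a * φ r₁) ^ p := by
  have hr' : r ∈ Icc (0 : ℝ) 1 := ⟨hr.1, hr.2.trans w.left_lt_one.le⟩
  refine truncPow_le_rpow hp ((S.le_mul w.toIsProfile hr').trans ?_) w.level_mul_nonneg
  exact mul_le_mul hα (w.monotoneOn hr' (w.mem_unit w.left_mem) hr.2) (w.pos r hr').le
    (zero_le_one.trans w.one_lt_level.le)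

end IsShot

/-- A shot from a level in `[1/2, a]` that is nondecreasing on the window `[r₁, 1]` and enters it
with positive value and slope bounded below independently of `p`. -/
structure IsIncreasingShot (d : ℕ) (V φ : ℝ → ℝ) (r₁ a p α : ℝ) (u h : ℝ → ℝ) : Prop
    extends IsShot d V φ p α u h where
  level_mem : α ∈ Icc (1 / 2) a
  deriv_nonneg_window : ∀ r ∈ Icc r₁ 1, 0 ≤ deriv u r
  pos_left : 0 < u r₁
  le_deriv_left : deriv φ 1 / 16 ≤ deriv u r₁

/-- The energy `(r^d u')² / 2 + r^(2d) u^(p+1) / (p+1)`. It ignores the potential term, whose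
contribution to its derivative has a favourable sign as long as `u` increases. -/
noncomputable def shotEnergy (d : ℕ) (p : ℝ) (u : ℝ → ℝ) (r : ℝ) : ℝ :=
  (r ^ d * deriv u r) ^ 2 / 2 + (r ^ d) ^ 2 * (u r ^ (p + 1) / (p + 1))

theorem HasRadialLaplacian.hasDerivAt_shotEnergy {d : ℕ} {u h : ℝ → ℝ} {p : ℝ}
    (U : HasRadialLaplacian d u h) (hp : 0 ≤ p) (r : ℝ) :
    HasDerivAt (shotEnergy d p u)
      ((r ^ d) ^ 2 * (deriv u r * (h r + u r ^ p)) +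
        2 * r ^ d * (d * r ^ (d - 1)) * (u r ^ (p + 1) / (p + 1))) r := by
  have hkin := ((U.hasDerivAt_pow_mul_deriv r).pow 2).div_const 2
  have hpot := ((hasDerivAt_pow d r).pow 2).mul
    (((U.hasDerivAt r).rpow_const (p := p + 1) (Or.inr (by linarith))).div_const (p + 1))
  refine (hkin.add hpot).congr_deriv ?_
  have hp1 : p + 1 ≠ 0 := by positivity
  rw [add_sub_cancel_right, Pi.pow_apply]
  field_simp
  ring

namespace IsIncreasingShot

variable {d : ℕ} {V φ k u h : ℝ → ℝ} {p α r₁ a R r s : ℝ}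

theorem level_le_two (I : IsIncreasingShot d V φ r₁ a p α u h)
    (w : ShootingWindow d V φ k r₁ a) : α ≤ 2 :=
  I.level_mem.2.trans w.level_le_two

theorem level_nonneg (I : IsIncreasingShot d V φ r₁ a p α u h) : 0 ≤ α :=
  (by norm_num : (0 : ℝ) ≤ 1 / 2).trans I.level_mem.1

theorem monotoneOn_window (I : IsIncreasingShot d V φ r₁ a p α u h) : MonotoneOn u (Icc r₁ 1) :=
  I.monotoneOn (convex_Icc r₁ 1) I.deriv_nonneg_window

theorem le_two (I : IsIncreasingShot d V φ r₁ a p α u h) (w : ShootingWindow d V φ k r₁ a)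
    (hr : r ∈ Icc (0 : ℝ) 1) : u r ≤ 2 :=
  (I.le_level w.toIsProfile I.level_nonneg hr).trans (I.level_le_two w)

theorem pos_window (I : IsIncreasingShot d V φ r₁ a p α u h) (w : ShootingWindow d V φ k r₁ a)
    (hr : r ∈ Icc r₁ 1) : 0 < u r :=
  I.pos_left.trans_le (I.monotoneOn_window w.left_mem hr hr.1)

theorem truncPow_eq_rpow (I : IsIncreasingShot d V φ r₁ a p α u h)
    (w : ShootingWindow d V φ k r₁ a) (hr : r ∈ Icc r₁ 1) :
    truncPow p (u r) = u r ^ p :=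
  truncPow_of_mem ⟨(I.pos_window w hr).le, I.le_two w (w.mem_unit hr)⟩

theorem deriv_le_two_mul (I : IsIncreasingShot d V φ r₁ a p α u h)
    (w : ShootingWindow d V φ k r₁ a) (hr : r ∈ Icc (0 : ℝ) 1) : deriv u r ≤ 2 * deriv φ r :=
  (I.deriv_le_ratio w.toIsProfile hr).trans (mul_le_mul_of_nonneg_right
    ((I.ratio_le w.toIsProfile hr).trans (I.level_le_two w)) (w.deriv_nonneg hr))

theorem radWronskian_one_le (I : IsIncreasingShot d V φ r₁ a p α u h)
    (w : ShootingWindow d V φ k r₁ a) : radWronskian d φ u 1 ≤ 2 * deriv φ 1 := by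
  rw [radWronskian, one_pow, one_mul, w.one, mul_one]
  have := mul_le_mul_of_nonneg_right (I.le_two w (w.mem_unit w.right_mem)) w.deriv_one_pos.le
  linarith [I.deriv_nonneg_window 1 w.right_mem]

/-- Integrating Lagrange's identity over `[r, 1]` bounds the mass of the power uniformly in `p`. -/
theorem mul_truncPow_mul_le (I : IsIncreasingShot d V φ r₁ a p α u h)
    (w : ShootingWindow d V φ k r₁ a) (hp : 0 ≤ p) (hr : r ∈ Icc r₁ 1) :
    r₁ ^ d * φ 0 * truncPow p (u r) * (1 - r) ≤ 2 * deriv φ 1 := by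
  have hsub : Icc r 1 ⊆ Icc r₁ 1 := Icc_subset_Icc_left hr.1
  have hW : ∀ s ∈ Icc r 1,
      HasDerivAt (radWronskian d φ u) (s ^ d * (φ s * truncPow p (u s))) s := fun s hs =>
    I.hasDerivAt_radWronskian w.toIsProfile (w.mem_unit (hsub hs))
  have hderiv : ∀ s ∈ interior (Icc r 1),
      r₁ ^ d * φ 0 * truncPow p (u r) ≤ deriv (radWronskian d φ u) s := by
    intro s hs
    have hs' := interior_subset hs
    rw [(hW s hs').deriv, mul_assoc]
    have hφ : φ 0 ≤ φ s := w.zero_le (w.mem_unit (hsub hs'))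
    have hpow : truncPow p (u r) ≤ truncPow p (u s) :=
      monotone_truncPow hp (I.monotoneOn_window hr (hsub hs') hs'.1)
    have hT := truncPow_nonneg p (u r)
    have hφ0 := w.zero_pos
    have hr₁ := w.left_pos
    have hr₁s : r₁ ≤ s := (hsub hs').1
    gcongr
    exacts [pow_nonneg (hr₁.le.trans hr₁s) d, hφ0.le.trans hφ]
  have hmvt := Convex.mul_sub_le_image_sub_of_le_deriv (convex_Icc r 1)
    (fun s hs => (hW s hs).continuousAt.continuousWithinAt)
    (fun s hs => (hW s (interior_subset hs)).differentiableAt.differentiableWithinAt)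
    hderiv r ⟨le_rfl, hr.2⟩ 1 ⟨hr.2, le_rfl⟩ hr.2
  linarith [I.radWronskian_one_le w, I.radWronskian_nonneg w.toIsProfile (w.mem_unit hr)]

theorem shotEnergy_monotoneOn (I : IsIncreasingShot d V φ r₁ a p α u h)
    (w : ShootingWindow d V φ k r₁ a) (hp : 0 ≤ p) :
    MonotoneOn (shotEnergy d p u) (Icc r₁ 1) := by
  refine monotoneOn_of_hasDerivWithinAt_nonneg (convex_Icc r₁ 1)
    (fun r _ => (I.hasDerivAt_shotEnergy hp r).continuousAt.continuousWithinAt)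
    (fun r _ => (I.hasDerivAt_shotEnergy hp r).hasDerivWithinAt) fun r hr => ?_
  have hr' := interior_subset hr
  have hr01 := w.mem_unit hr'
  have hu := I.pos_window w hr'
  have hr0 := hr01.1
  rw [I.source r hr01, I.truncPow_eq_rpow w hr', sub_add_cancel]
  have hdu := I.deriv_nonneg_window r hr'
  have hV := w.potential_nonneg r hr01
  positivity

theorem le_deriv_or_le_truncPow (I : IsIncreasingShot d V φ r₁ a p α u h)
    (w : ShootingWindow d V φ k r₁ a) (hp : 0 ≤ p) (hR : R ∈ Icc r₁ 1) :
    entrySlope d φ r₁ / 2 ≤ deriv u R ∨ entrySlope d φ r₁ ^ 2 * p / 8 ≤ truncPow p (u R) := by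
  set K := entrySlope d φ r₁
  have hK : 0 ≤ K := w.entrySlope_pos.le
  have hK₁ : K ≤ r₁ ^ d * deriv u r₁ :=
    mul_le_mul_of_nonneg_left I.le_deriv_left (pow_nonneg w.left_pos.le d)
  refine or_iff_not_imp_left.2 fun hlt => ?_
  have hu := I.pos_window w hR
  have hR01 := w.mem_unit hR
  have hRd : (R ^ d) ^ 2 ≤ 1 := pow_le_one₀ (pow_nonneg hR01.1 d) (pow_le_one₀ hR01.1 hR01.2)
  have hkin : (R ^ d * deriv u R) ^ 2 ≤ (K / 2) ^ 2 := by
    rw [mul_pow]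
    exact (mul_le_of_le_one_left (sq_nonneg _) hRd).trans
      (pow_le_pow_left₀ (I.deriv_nonneg_window R hR) (not_le.1 hlt).le 2)
  have hpot : (R ^ d) ^ 2 * (u R ^ (p + 1) / (p + 1)) ≤ u R ^ p * 2 / (p + 1) := by
    refine (mul_le_of_le_one_left (by positivity) hRd).trans ?_
    rw [Real.rpow_add_one hu.ne']
    gcongr
    exact I.le_two w hR01
  have hleft : K ^ 2 / 2 ≤ shotEnergy d p u r₁ :=
    (div_le_div_of_nonneg_right (pow_le_pow_left₀ hK hK₁ 2) zero_le_two).trans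
      (le_add_of_nonneg_right (mul_nonneg (sq_nonneg _)
        (div_nonneg (Real.rpow_nonneg I.pos_left.le _) (by linarith))))
  have hmono := I.shotEnergy_monotoneOn w hp w.left_mem hR hR.1
  have hmain : K ^ 2 * (3 / 8) ≤ u R ^ p * 2 / (p + 1) :=
    calc K ^ 2 * (3 / 8) = K ^ 2 / 2 - (K / 2) ^ 2 / 2 := by ring
      _ ≤ shotEnergy d p u R - (R ^ d * deriv u R) ^ 2 / 2 :=
        sub_le_sub (hleft.trans hmono) (div_le_div_of_nonneg_right hkin zero_le_two)
      _ = (R ^ d) ^ 2 * (u R ^ (p + 1) / (p + 1)) := add_sub_cancel_left _ _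
      _ ≤ u R ^ p * 2 / (p + 1) := hpot
  rw [I.truncPow_eq_rpow w hR]
  have hmain' := (le_div_iff₀ (by linarith)).1 hmain
  nlinarith [mul_nonneg (sq_nonneg K) hp, sq_nonneg K]

end IsIncreasingShot

namespace ShootingWindow

variable {d : ℕ} {V φ k : ℝ → ℝ} {r₁ a ε η ρ y : ℝ}

theorem smallness_pos (w : ShootingWindow d V φ k r₁ a) :
    0 < min (φ 0 / 4) (deriv φ 1 / 16) :=
  lt_min (div_pos w.zero_pos (by norm_num)) (div_pos w.deriv_one_pos (by norm_num))

theorem eventually_enter (w : ShootingWindow d V φ k r₁ a) :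
    ∀ᶠ p : ℝ in atTop, ∀ ⦃α u h⦄, IsShot d V φ p α u h → α ∈ Icc (1 / 2) a →
      0 < u r₁ ∧ deriv φ 1 / 16 ≤ deriv u r₁ := by
  filter_upwards [eventually_rpow_le w.level_mul_nonneg w.level_mul_lt_one w.smallness_pos,
    eventually_ge_atTop 0] with p hp hp0 α u h S hα
  have hM : ∀ s ∈ Icc 0 r₁, truncPow p (u s) ≤ (a * φ r₁) ^ p := fun s hs =>
    S.truncPow_le_left w hp0 hα.2 hs
  have hr₁ := w.mem_unit w.left_mem
  have hratio := S.one_fourth_le_ratio w.toIsProfile hα.1 hr₁ (hp.trans (min_le_left _ _)) hM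
  refine ⟨?_, S.le_deriv_of_truncPow_le w hα.1 w.left_mem (hp.trans (min_le_left _ _))
    (hp.trans (min_le_right _ _)) hM⟩
  exact (div_pos_iff_of_pos_right (w.pos r₁ hr₁)).1 (lt_of_lt_of_le (by norm_num) hratio)

theorem eventually_apply_lt (w : ShootingWindow d V φ k r₁ a) (hρ : ρ ∈ Ico r₁ 1)
    (hy : y ∈ Ioc 1 2) :
    ∀ᶠ p : ℝ in atTop, ∀ ⦃α u h⦄, IsIncreasingShot d V φ r₁ a p α u h → u ρ < y := by
  set c : ℝ := r₁ ^ d * φ 0 * (1 - ρ)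
  have hc : 0 < c := mul_pos (mul_pos (pow_pos w.left_pos d) w.zero_pos) (sub_pos.2 hρ.2)
  filter_upwards [(tendsto_rpow_atTop_of_base_gt_one y hy.1).eventually_gt_atTop
    (2 * deriv φ 1 / c), eventually_ge_atTop 0] with p hp hp0 α u h I
  by_contra! hle
  have hpow : y ^ p ≤ truncPow p (u ρ) := by
    rw [← truncPow_of_mem ⟨zero_le_one.trans hy.1.le, hy.2⟩]
    exact monotone_truncPow hp0 hle
  have hmass := I.mul_truncPow_mul_le w hp0 (Ico_subset_Icc_self hρ)
  rw [mul_right_comm, ← le_div_iff₀' hc] at hmass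
  exact absurd (hpow.trans hmass) (not_le.2 hp)

theorem eventually_apply_one_le (w : ShootingWindow d V φ k r₁ a) (hη : 0 < η) :
    ∀ᶠ p : ℝ in atTop, ∀ ⦃α u h⦄, IsIncreasingShot d V φ r₁ a p α u h → u 1 ≤ 1 + η := by
  obtain ⟨B, hB0, hB⟩ := w.exists_deriv_le
  set ρ : ℝ := max r₁ (1 - η / (4 * (B + 1)))
  have hδ : 0 < η / (4 * (B + 1)) := by positivity
  have hρ : ρ ∈ Ico r₁ 1 := ⟨le_max_left _ _, max_lt w.left_lt_one (by linarith)⟩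
  have hy : min (1 + η / 2) 2 ∈ Ioc (1 : ℝ) 2 :=
    ⟨lt_min (by linarith) one_lt_two, min_le_right _ _⟩
  filter_upwards [w.eventually_apply_lt hρ hy] with p hp α u h I
  have hmvt := I.sub_le_mul_sub (C := 2 * (B + 1)) hρ.2.le fun s hs => by
    have hs' := w.mem_unit ⟨hρ.1.trans hs.1, hs.2⟩
    linarith [I.deriv_le_two_mul w hs', hB s hs']
  have hstep : 2 * (B + 1) * (1 - ρ) ≤ η / 2 := by
    calc 2 * (B + 1) * (1 - ρ) ≤ 2 * (B + 1) * (η / (4 * (B + 1))) := by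
          gcongr
          linarith [le_max_right r₁ (1 - η / (4 * (B + 1)))]
      _ = η / 2 := by
          field_simp
          norm_num
  linarith [(hp I).trans_le (min_le_left _ _)]

theorem eventually_le_deriv (w : ShootingWindow d V φ k r₁ a) (hη : 0 < η) :
    ∀ᶠ p : ℝ in atTop, ∀ ⦃α u h⦄, IsIncreasingShot d V φ r₁ a p α u h →
      ∀ r ∈ Icc r₁ (1 - η), entrySlope d φ r₁ / 2 ≤ deriv u r := by
  have hK := w.entrySlope_pos
  have hc : 0 < r₁ ^ d * φ 0 := mul_pos (pow_pos w.left_pos d) w.zero_pos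
  have hlarge := (tendsto_id.const_mul_atTop
    (by positivity : 0 < r₁ ^ d * φ 0 * (entrySlope d φ r₁ ^ 2 / 8) * η)).eventually_gt_atTop
    (2 * deriv φ 1)
  filter_upwards [hlarge, eventually_ge_atTop 0] with p hp hp0 α u h I r hr
  have hr' : r ∈ Icc r₁ 1 := ⟨hr.1, hr.2.trans (by linarith)⟩
  refine (I.le_deriv_or_le_truncPow w hp0 hr').resolve_right fun hT => hp.not_ge ?_
  calc _ = r₁ ^ d * φ 0 * (entrySlope d φ r₁ ^ 2 * p / 8) * η := by
        rw [id]
        ring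
    _ ≤ r₁ ^ d * φ 0 * truncPow p (u r) * (1 - r) := by
        gcongr
        · exact mul_nonneg hc.le (truncPow_nonneg _ _)
        · linarith [hr.2]
    _ ≤ 2 * deriv φ 1 := I.mul_truncPow_mul_le w hp0 hr'

theorem exists_eventually_apply_le (w : ShootingWindow d V φ k r₁ a) (hη : 0 < η) :
    ∃ θ ∈ Ico (0 : ℝ) 1, ∀ᶠ p : ℝ in atTop, ∀ ⦃α u h⦄, IsIncreasingShot d V φ r₁ a p α u h →
      ∀ r ∈ Icc 0 (1 - η), u r ≤ θ := by
  set κ := entrySlope d φ r₁ / 2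
  have hκ : 0 < κ := half_pos w.entrySlope_pos
  have hκη : 0 < κ * η := mul_pos hκ hη
  refine ⟨max (a * φ r₁) (1 - κ * η / 4), ⟨le_max_of_le_left w.level_mul_nonneg,
    max_lt w.level_mul_lt_one (by linarith)⟩, ?_⟩
  filter_upwards [w.eventually_apply_one_le (show 0 < κ * η / 4 by positivity),
    w.eventually_le_deriv (half_pos hη)] with p hone hslope α u h I r hr
  rcases le_total r r₁ with hle | hle
  · have hr' : r ∈ Icc (0 : ℝ) 1 := ⟨hr.1, hle.trans w.left_lt_one.le⟩
    exact le_max_of_le_left ((I.le_mul w.toIsProfile hr').trans (mul_le_mul I.level_mem.2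
      (w.monotoneOn hr' (w.mem_unit w.left_mem) hle) (w.pos r hr').le
      (zero_le_one.trans w.one_lt_level.le)))
  · have hmvt : κ * (1 - η / 2 - r) ≤ u (1 - η / 2) - u r :=
      I.mul_sub_le_sub (by linarith [hr.2]) fun s hs => hslope I s ⟨hle.trans hs.1, hs.2⟩
    have hgap : κ * (η / 2) ≤ κ * (1 - η / 2 - r) :=
      mul_le_mul_of_nonneg_left (by linarith [hr.2]) hκ.le
    have hmono : u (1 - η / 2) ≤ u 1 :=
      I.monotoneOn_window ⟨by linarith [hr.2], by linarith⟩ w.right_mem (by linarith)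
    exact le_max_of_le_right (by linarith [hone I])

theorem eventually_truncPow_le (w : ShootingWindow d V φ k r₁ a) (hη : 0 < η) (hε : 0 < ε) :
    ∀ᶠ p : ℝ in atTop, ∀ ⦃α u h⦄, IsIncreasingShot d V φ r₁ a p α u h →
      ∀ r ∈ Icc 0 (1 - η), truncPow p (u r) ≤ ε := by
  obtain ⟨θ, ⟨hθ0, hθ1⟩, hθ⟩ := w.exists_eventually_apply_le hη
  filter_upwards [hθ, eventually_rpow_le hθ0 hθ1 hε, eventually_ge_atTop 0]
    with p hp hpow hp0 α u h I r hr
  exact (truncPow_le_rpow hp0 (hp I r hr) hθ0).trans hpow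

theorem eventually_level_le (w : ShootingWindow d V φ k r₁ a) (hε : 0 < ε) :
    ∀ᶠ p : ℝ in atTop, ∀ ⦃α u h⦄, IsIncreasingShot d V φ r₁ a p α u h → α ≤ u 1 + ε := by
  have hφ0 := w.zero_pos
  have hcont : Continuous fun η => 2 * (1 - φ (1 - η)) + η / φ 0 := by
    have := w.continuous
    fun_prop
  have hsmall : ∀ᶠ η in 𝓝[>] (0 : ℝ), 2 * (1 - φ (1 - η)) + η / φ 0 < ε ∧ η < 1 - r₁ := by
    refine (hcont.continuousAt.eventually (gt_mem_nhds ?_)).and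
      (gt_mem_nhds (sub_pos.2 w.left_lt_one)) |>.filter_mono nhdsWithin_le_nhds
    simpa only [sub_zero, w.one, sub_self, mul_zero, zero_div, add_zero] using hε
  obtain ⟨η, ⟨hηε, hηr⟩, hη⟩ := (hsmall.and self_mem_nhdsWithin).exists
  have hη : 0 < η := hη
  have hmem : 1 - η ∈ Icc r₁ 1 := ⟨by linarith, by linarith⟩
  have hmem' := w.mem_unit hmem
  filter_upwards [w.eventually_truncPow_le hη hη] with p hp α u h I
  have hratio := (le_div_iff₀ (w.pos _ hmem')).1 (I.sub_le_ratio w.toIsProfile hmem' (hp I))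
  have hmono := I.monotoneOn_window hmem w.right_mem hmem.2
  have hφ1 := w.le_one hmem'
  have hlevel : α * (1 - φ (1 - η)) ≤ 2 * (1 - φ (1 - η)) :=
    mul_le_mul_of_nonneg_right (I.level_le_two w) (sub_nonneg.2 hφ1)
  have hdrop : η / φ 0 * φ (1 - η) ≤ η / φ 0 := mul_le_of_le_one_right (by positivity) hφ1
  linarith

end ShootingWindow

theorem exists_level_isLeast_zero {K : Type*} [TopologicalSpace K] [CompactSpace K] [Nonempty K]
    {F : ℝ → K → ℝ} {α₀ α₁ : ℝ} (hα : α₀ ≤ α₁) (hF : Continuous fun x : ℝ × K => F x.1 x.2)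
    (h0 : ∀ x, 0 ≤ F α₀ x) (h1 : ∃ x, F α₁ x ≤ 0) :
    ∃ α ∈ Icc α₀ α₁, IsLeast (range (F α)) 0 := by
  have hleast : ∀ α, IsLeast (range (F α)) (sInf (range (F α))) := fun α =>
    (isCompact_range (hF.comp (Continuous.prodMk_right α))).isLeast_sInf (range_nonempty _)
  have hcont : Continuous fun α => sInf (range (F α)) := by
    simpa only [image_univ] using isCompact_univ.continuous_sInf hF
  have h0' : 0 ≤ sInf (range (F α₀)) := Real.sInf_nonneg (forall_mem_range.2 h0)
  obtain ⟨x, hx⟩ := h1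
  have h1' : sInf (range (F α₁)) ≤ 0 := ((hleast α₁).2 (mem_range_self x)).trans hx
  obtain ⟨α, hαmem, hαeq⟩ := intermediate_value_Icc' hα hcont.continuousOn ⟨h1', h0'⟩
  exact ⟨α, hαmem, hαeq ▸ hleast α⟩

namespace ShootingWindow

variable {d : ℕ} {V φ k : ℝ → ℝ} {r₁ a ε θ : ℝ}

/-- At an interior critical point the source `V u - u ^ p` vanishes, so `u ^ p` is bounded there;
the energy forbids this for large `p`. -/
theorem eventually_eq_one_of_deriv_eq_zero (w : ShootingWindow d V φ k r₁ a) :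
    ∀ᶠ p : ℝ in atTop, ∀ ⦃α u h⦄, IsIncreasingShot d V φ r₁ a p α u h →
      ∀ r ∈ Icc r₁ 1, deriv u r = 0 → r = 1 := by
  obtain ⟨B, hB⟩ := isCompact_Icc.exists_bound_of_continuousOn
    (w.continuous_source.continuousOn (s := Icc (0 : ℝ) 1))
  have hK := w.entrySlope_pos
  have hlarge := (tendsto_id.const_mul_atTop
    (by positivity : 0 < entrySlope d φ r₁ ^ 2 / 8)).eventually_gt_atTop (2 * B)
  filter_upwards [hlarge, eventually_ge_atTop 0] with p hp hp0 α u h I r hr hdu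
  by_contra hne
  have hr' := w.mem_unit hr
  have hr₁ : r₁ < r := hr.1.lt_of_ne fun h => by
    have := I.le_deriv_left
    rw [h, hdu] at this
    linarith [w.deriv_one_pos]
  have hmin : IsLocalMin (deriv u) r := by
    filter_upwards [Icc_mem_nhds hr₁ (hr.2.lt_of_ne hne)] with s hs
    exact hdu ▸ I.deriv_nonneg_window s hs
  have hsource : h r = 0 := by
    simpa only [hdu, mul_zero, sub_zero] using
      hmin.hasDerivAt_eq_zero (I.hasDerivAt_deriv (w.left_pos.trans hr₁).ne')
  have hT : truncPow p (u r) ≤ 2 * B := by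
    have hV := mul_le_mul_of_nonneg_left ((I.le_mul w.toIsProfile hr').trans
      (mul_le_mul_of_nonneg_right (I.level_le_two w) (w.pos r hr').le)) (w.potential_nonneg r hr')
    rw [mul_left_comm, ← w.source r hr'] at hV
    linarith [I.source r hr', (le_abs_self _).trans (hB r hr')]
  rcases I.le_deriv_or_le_truncPow w hp0 hr with hslope | hpow
  · linarith
  · rw [id] at hp
    linarith

theorem eventually_le_deriv_of_level_le (w : ShootingWindow d V φ k r₁ a) (hθ0 : 0 ≤ θ)
    (hθ1 : θ < 1) :
    ∀ᶠ p : ℝ in atTop, ∀ ⦃α u h⦄, IsShot d V φ p α u h → α ∈ Icc (1 / 2) θ →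
      ∀ r ∈ Icc r₁ 1, deriv φ 1 / 16 ≤ deriv u r := by
  filter_upwards [eventually_rpow_le hθ0 hθ1 w.smallness_pos, eventually_ge_atTop 0]
    with p hp hp0 α u h S hα r hr
  have hM : ∀ s ∈ Icc 0 r, truncPow p (u s) ≤ θ ^ p := fun s hs =>
    truncPow_le_rpow hp0 ((S.le_level w.toIsProfile ((by norm_num : (0 : ℝ) ≤ 1 / 2).trans hα.1)
      ⟨hs.1, hs.2.trans hr.2⟩).trans hα.2) hθ0
  exact S.le_deriv_of_truncPow_le w hα.1 hr (hp.trans (min_le_left _ _))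
    (hp.trans (min_le_right _ _)) hM

theorem eventually_exists_deriv_nonpos (w : ShootingWindow d V φ k r₁ a) :
    ∀ᶠ p : ℝ in atTop, ∀ ⦃u h⦄, IsShot d V φ p a u h → ∃ r ∈ Icc r₁ 1, deriv u r ≤ 0 := by
  have hε : 0 < (a - 1) / 4 := div_pos (sub_pos.2 w.one_lt_level) (by norm_num)
  have hmem : a ∈ Icc (1 / 2) a := ⟨by linarith [w.one_lt_level], le_rfl⟩
  filter_upwards [w.eventually_enter, w.eventually_level_le hε, w.eventually_apply_one_le hε]
    with p henter hlevel hone u h S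
  by_contra! hpos
  have I : IsIncreasingShot d V φ r₁ a p a u h :=
    ⟨S, hmem, fun r hr => (hpos r hr).le, (henter S hmem).1, (henter S hmem).2⟩
  linarith [hlevel I, hone I, w.one_lt_level]

theorem eventually_exists_isIncreasingShot (w : ShootingWindow d V φ k r₁ a)
    (hV : ContinuousOn V (Icc 0 1)) :
    ∀ᶠ p : ℝ in atTop, ∃ α u h, IsIncreasingShot d V φ r₁ a p α u h ∧ deriv u 1 = 0 := by
  filter_upwards [eventually_ge_atTop 1, w.eventually_enter,
    w.eventually_le_deriv_of_level_le (θ := 1 / 2) (by norm_num) (by norm_num),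
    w.eventually_exists_deriv_nonpos, w.eventually_eq_one_of_deriv_eq_zero]
    with p hp henter hlow hhigh hcrit
  obtain ⟨u, h, S, C, hC⟩ := exists_isShot_family d φ hV hp
  have : Nonempty (Icc r₁ 1) := ⟨⟨r₁, w.left_mem⟩⟩
  have hF : Continuous fun x : ℝ × Icc r₁ 1 => deriv (u x.1) x.2 :=
    continuous_prod_of_continuous_lipschitzWith _ C
      (fun α => (S α).continuous_deriv.comp continuous_subtype_val)
      fun r => hC r (w.mem_unit r.2)
  have hstart : ∀ r : Icc r₁ 1, 0 ≤ deriv (u (1 / 2)) r := fun r =>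
    (div_nonneg w.deriv_one_pos.le (by norm_num)).trans
      (hlow (S (1 / 2)) ⟨le_rfl, le_rfl⟩ r r.2)
  obtain ⟨r, hr, hend⟩ := hhigh (S a)
  obtain ⟨α, hα, ⟨⟨s, hs⟩, hs0⟩, hnonneg⟩ := exists_level_isLeast_zero
    (F := fun α (r : Icc r₁ 1) => deriv (u α) r) (by linarith [w.one_lt_level]) hF hstart
    ⟨⟨r, hr⟩, hend⟩
  have I : IsIncreasingShot d V φ r₁ a p α (u α) (h α) :=
    ⟨S α, hα, fun r hr => hnonneg ⟨⟨r, hr⟩, rfl⟩, (henter (S α) hα).1, (henter (S α) hα).2⟩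
  exact ⟨α, u α, h α, I, hcrit I s hs hs0 ▸ hs0⟩

theorem eventually_abs_ratio_sub_one_le (w : ShootingWindow d V φ k r₁ a) (hε : 0 < ε) :
    ∀ᶠ p : ℝ in atTop, ∀ ⦃α u h⦄, IsIncreasingShot d V φ r₁ a p α u h → deriv u 1 = 0 →
      ∀ r ∈ Icc (0 : ℝ) 1, |u r / φ r - 1| ≤ ε := by
  have hθ : max 0 (1 - ε / 2) < 1 := max_lt one_pos (by linarith)
  filter_upwards [w.eventually_le_deriv_of_level_le (le_max_left _ _) hθ,
    w.eventually_level_le (half_pos hε), w.eventually_apply_one_le (half_pos hε)]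
    with p hlow hlevel hone α u h I hN r hr
  have hα : 1 - ε / 2 ≤ α := by
    by_contra! hlt
    have := hlow I.toIsShot ⟨I.level_mem.1, le_max_of_le_right hlt.le⟩ 1 w.right_mem
    linarith [w.deriv_one_pos]
  have hle := I.ratio_le w.toIsProfile hr
  have hge := I.ratio_antitoneOn w.toIsProfile hr ⟨zero_le_one, le_rfl⟩ hr.2
  simp only [w.one, div_one] at hge
  rw [abs_le]
  constructor <;> linarith [hlevel I, hone I]

theorem eventually_abs_deriv_sub_le (w : ShootingWindow d V φ k r₁ a) (hε : 0 < ε) :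
    ∀ᶠ p : ℝ in atTop, ∀ ⦃α u h⦄, IsIncreasingShot d V φ r₁ a p α u h → deriv u 1 = 0 →
      ∀ r ∈ Icc 0 (1 - ε), |deriv u r - deriv φ r| ≤ ε := by
  obtain ⟨B, hB0, hB⟩ := w.exists_deriv_le
  filter_upwards [w.eventually_abs_ratio_sub_one_le (show 0 < ε / (2 * (B + 1)) by positivity),
    w.eventually_truncPow_le hε (half_pos hε)] with p hratio hpow α u h I hN r hr
  have hr' : r ∈ Icc (0 : ℝ) 1 := ⟨hr.1, hr.2.trans (by linarith)⟩
  have hlin : |(u r / φ r - 1) * deriv φ r| ≤ ε / 2 := by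
    rw [abs_mul, abs_of_nonneg (w.deriv_nonneg hr')]
    calc _ ≤ ε / (2 * (B + 1)) * (B + 1) := by
          gcongr
          exacts [w.deriv_nonneg hr', hratio I hN r hr',
            (hB r hr').trans (le_add_of_nonneg_right zero_le_one)]
      _ = ε / 2 := by field_simp
  have hflux : |radWronskian d φ u r / (r ^ d * φ r)| ≤ ε / 2 := by
    rw [abs_of_nonneg (div_nonneg (I.radWronskian_nonneg w.toIsProfile hr')
      (mul_nonneg (pow_nonneg hr'.1 d) (w.pos r hr').le))]
    rcases hr'.1.eq_or_lt with rfl | hr0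
    · rw [w.radWronskian_zero I.toHasRadialLaplacian, zero_div]
      positivity
    · exact I.radWronskian_div_le w.toIsProfile ⟨hr0, hr'.2⟩ fun s hs =>
        hpow I s ⟨hs.1, hs.2.trans hr.2⟩
  have hsplit : deriv u r - deriv φ r =
      (u r / φ r - 1) * deriv φ r - radWronskian d φ u r / (r ^ d * φ r) := by
    rw [I.deriv_eq_ratio w.toIsProfile hr']
    ring
  rw [hsplit]
  exact (abs_sub _ _).trans (by linarith)

theorem exists_eventually_abs_deriv_sub_le (w : ShootingWindow d V φ k r₁ a) :
    ∃ C, ∀ᶠ p : ℝ in atTop, ∀ ⦃α u h⦄, IsIncreasingShot d V φ r₁ a p α u h → deriv u 1 = 0 →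
      ∀ r ∈ Icc (0 : ℝ) 1, |deriv u r - deriv φ r| ≤ C := by
  obtain ⟨B, -, hB⟩ := w.exists_deriv_le
  refine ⟨max (1 - r₁) B, ?_⟩
  filter_upwards [w.eventually_abs_deriv_sub_le (sub_pos.2 w.left_lt_one)]
    with p hp α u h I hN r hr
  rcases le_total r r₁ with hle | hle
  · exact le_max_of_le_left (hp I hN r ⟨hr.1, by linarith⟩)
  · refine le_max_of_le_right ((abs_le.2 ⟨?_, ?_⟩).trans (hB r hr))
    · linarith [I.deriv_nonneg_window r ⟨hle, hr.2⟩]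
    · linarith [I.deriv_le_two_mul w hr]

end ShootingWindow

/-- `u` is a positive solution of `u'' + (d / r) u' = V u - u ^ p` on `[0, 1]` with
`u'(0) = u'(1) = 0`, and `h` is a continuous extension of the right-hand side. -/
structure IsRadialNeumannSolution (d : ℕ) (V : ℝ → ℝ) (p : ℝ) (u h : ℝ → ℝ) : Prop
    extends HasRadialLaplacian d u h where
  pos : ∀ r ∈ Icc (0 : ℝ) 1, 0 < u r
  source : ∀ r ∈ Icc (0 : ℝ) 1, h r = V r * u r - u r ^ p
  deriv_one : deriv u 1 = 0

theorem IsProfile.exists_isRadialNeumannSolution_family {d : ℕ} {V φ k : ℝ → ℝ}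
    (P : IsProfile d V φ k) (hV : ContinuousOn V (Icc 0 1)) :
    ∃ u h : ℝ → ℝ → ℝ, (∀ᶠ p in atTop, IsRadialNeumannSolution d V p (u p) (h p)) ∧
      TendstoUniformlyOn u φ atTop (Icc 0 1) ∧
      (∀ r ∈ Ico (0 : ℝ) 1, Tendsto (fun p => deriv (u p) r) atTop (𝓝 (deriv φ r))) ∧
      ∃ C, ∀ᶠ p in atTop, ∀ r ∈ Icc (0 : ℝ) 1, |deriv (u p) r - deriv φ r| ≤ C := by
  obtain ⟨r₁, a, w⟩ := P.exists_shootingWindow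
  obtain ⟨α, hα⟩ := (w.eventually_exists_isIncreasingShot hV).choice
  obtain ⟨u, hu⟩ := hα.choice
  obtain ⟨h, hI⟩ := hu.choice
  obtain ⟨C, hC⟩ := w.exists_eventually_abs_deriv_sub_le
  refine ⟨u, h, ?_, Metric.tendstoUniformlyOn_iff.2 fun ε hε => ?_, fun r hr => ?_, C, ?_⟩
  · filter_upwards [hI, w.eventually_abs_ratio_sub_one_le one_half_pos] with p hIp hratio
    have hpos : ∀ r ∈ Icc (0 : ℝ) 1, 0 < u p r := fun r hr =>
      (div_pos_iff_of_pos_right (P.pos r hr)).1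
        (by linarith [(abs_le.1 (hratio hIp.1 hIp.2 r hr)).1])
    exact ⟨hIp.1.toHasRadialLaplacian, hpos, fun r hr => by
      rw [hIp.1.source r hr, truncPow_of_mem ⟨(hpos r hr).le, hIp.1.le_two w hr⟩], hIp.2⟩
  · filter_upwards [hI, w.eventually_abs_ratio_sub_one_le (half_pos hε)] with p hIp hratio r hr
    have hφ := P.pos r hr
    have hdiff : u p r - φ r = (u p r / φ r - 1) * φ r := by field_simp
    rw [dist_comm, Real.dist_eq, hdiff, abs_mul, abs_of_pos hφ]
    exact (mul_le_of_le_one_right (abs_nonneg _) (P.le_one hr)).trans_lt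
      ((hratio hIp.1 hIp.2 r hr).trans_lt (half_lt_self hε))
  · refine Metric.tendsto_nhds.2 fun ε hε => ?_
    have hδ : 0 < min (ε / 2) (1 - r) := lt_min (half_pos hε) (sub_pos.2 hr.2)
    filter_upwards [hI, w.eventually_abs_deriv_sub_le hδ] with p hIp hderiv
    exact (hderiv hIp.1 hIp.2 r ⟨hr.1, by linarith [min_le_right (ε / 2) (1 - r)]⟩).trans_lt
      ((min_le_left _ _).trans_lt (half_lt_self hε))
  · filter_upwards [hI, hC] with p hIp hbound
    exact hbound hIp.1 hIp.2

theorem contDiffOn_two_of_hasDerivAt {y y₁ y₂ : ℝ → ℝ} {s : Set ℝ} (hs : IsOpen s)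
    (h₁ : ∀ r ∈ s, HasDerivAt y (y₁ r) r) (h₂ : ∀ r ∈ s, HasDerivAt y₁ (y₂ r) r)
    (hc : ContinuousOn y₂ s) : ContDiffOn ℝ 2 y s := by
  have hy₁ : ContDiffOn ℝ 1 y₁ s := by
    rw [← zero_add 1, contDiffOn_succ_iff_deriv_of_isOpen hs, contDiffOn_zero]
    exact ⟨fun r hr => (h₂ r hr).differentiableAt.differentiableWithinAt,
      fun h => absurd h WithTop.zero_ne_top, hc.congr fun r hr => (h₂ r hr).deriv⟩
  rw [← one_add_one_eq_two, contDiffOn_succ_iff_deriv_of_isOpen hs]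
  exact ⟨fun r hr => (h₁ r hr).differentiableAt.differentiableWithinAt,
    fun h => absurd h WithTop.one_ne_top, hy₁.congr fun r hr => (h₁ r hr).deriv⟩

/-- `g` is a classical solution of the homogeneous equation `g'' + (d / r) g' = V g` on `s`. -/
structure IsRadialSolution (d : ℕ) (V g : ℝ → ℝ) (s : Set ℝ) : Prop where
  hasDerivAt : ∀ r ∈ s, HasDerivAt g (deriv g r) r
  hasDerivAt_deriv : ∀ r ∈ s, HasDerivAt (deriv g) (V r * g r - d / r * deriv g r) r

namespace IsRadialSolution

variable {d : ℕ} {V g : ℝ → ℝ} {s : Set ℝ}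

theorem of_contDiffOn (hs : IsOpen s) (hg : ContDiffOn ℝ 2 g s)
    (heq : ∀ r ∈ s, -deriv (deriv g) r - d / r * deriv g r + V r * g r = 0) :
    IsRadialSolution d V g s where
  hasDerivAt r hr :=
    ((hg.differentiableOn two_ne_zero).differentiableAt (hs.mem_nhds hr)).hasDerivAt
  hasDerivAt_deriv r hr := by
    rw [← one_add_one_eq_two, contDiffOn_succ_iff_deriv_of_isOpen hs] at hg
    have hg' := (hg.2.2.differentiableOn one_ne_zero).differentiableAt (hs.mem_nhds hr)
    exact hg'.hasDerivAt.congr_deriv (by linarith [heq r hr])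

theorem contDiffOn (S : IsRadialSolution d V g s) (hs : IsOpen s) (h0 : 0 ∉ s)
    (hV : ContinuousOn V s) : ContDiffOn ℝ 2 g s := by
  have hg : ContinuousOn g s := fun r hr => (S.hasDerivAt r hr).continuousAt.continuousWithinAt
  have hg' : ContinuousOn (deriv g) s := fun r hr =>
    (S.hasDerivAt_deriv r hr).continuousAt.continuousWithinAt
  have hinv : ContinuousOn (fun r : ℝ => (d : ℝ) / r) s :=
    continuousOn_const.div continuousOn_id fun r hr => ne_of_mem_of_not_mem hr h0
  exact contDiffOn_two_of_hasDerivAt hs S.hasDerivAt S.hasDerivAt_deriv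
    ((hV.mul hg).sub (hinv.mul hg'))

theorem equation_of_eventuallyEq (S : IsRadialSolution d V g s) {f : ℝ → ℝ} {c r : ℝ}
    (hr : r ∈ s) (hf : f =ᶠ[𝓝 r] fun t => c * g t) :
    -deriv (deriv f) r - d / r * deriv f r + V r * f r = 0 := by
  rw [hf.deriv.deriv_eq, hf.deriv_eq, hf.eq_of_nhds]
  simp only [deriv_const_mul_field']
  rw [(S.hasDerivAt_deriv r hr).deriv]
  ring

end IsRadialSolution

/-- `∫ᵣ¹ dt / (t ^ d φ(t) ^ 2)`, the factor by which reduction of order turns `φ` into a second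
solution of the same equation. -/
noncomputable def profileTail (d : ℕ) (φ : ℝ → ℝ) (r : ℝ) : ℝ :=
  ∫ t in r..1, (t ^ d * φ t ^ 2)⁻¹

/-- The second solution `ψ` of `ψ'' + (d / r) ψ' = V ψ`, with `ψ'(1) = 0`, obtained from `φ` by
reduction of order. -/
noncomputable def outerSol (d : ℕ) (φ : ℝ → ℝ) (r : ℝ) : ℝ :=
  φ r * (1 / deriv φ 1 + profileTail d φ r)

/-- The Green function, built from the two solutions `φ` and `ψ = outerSol d φ`. -/
noncomputable def radialGreen (d : ℕ) (φ : ℝ → ℝ) (r s : ℝ) : ℝ :=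
  s ^ d * (φ (min r s) * outerSol d φ (max r s))

section RadialGreen

variable {d : ℕ} {φ : ℝ → ℝ} {r s : ℝ}

theorem profileTail_one : profileTail d φ 1 = 0 :=
  intervalIntegral.integral_same

theorem radialGreen_of_le (h : r ≤ s) :
    radialGreen d φ r s = s ^ d * outerSol d φ s * φ r := by
  rw [radialGreen, min_eq_left h, max_eq_right h]
  ring

theorem radialGreen_of_ge (h : s ≤ r) :
    radialGreen d φ r s = s ^ d * φ s * outerSol d φ r := by
  rw [radialGreen, min_eq_right h, max_eq_left h]
  ring

theorem radialGreen_eventuallyEq_of_lt (h : r < s) :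
    (radialGreen d φ · s) =ᶠ[𝓝 r] fun t => s ^ d * outerSol d φ s * φ t := by
  filter_upwards [gt_mem_nhds h] with t ht using radialGreen_of_le (le_of_lt ht)

theorem radialGreen_eventuallyEq_of_gt (h : s < r) :
    (radialGreen d φ · s) =ᶠ[𝓝 r] fun t => s ^ d * φ s * outerSol d φ t := by
  filter_upwards [lt_mem_nhds h] with t ht using radialGreen_of_ge (le_of_lt ht)

end RadialGreen

namespace IsProfile

variable {d : ℕ} {V φ k : ℝ → ℝ} {r s : ℝ}

theorem isRadialSolution (P : IsProfile d V φ k) : IsRadialSolution d V φ (Ioo 0 1) where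
  hasDerivAt r _ := P.hasDerivAt r
  hasDerivAt_deriv r hr := by
    rw [← P.source r (Ioo_subset_Icc_self hr)]
    exact P.hasDerivAt_deriv hr.1.ne'

theorem pow_mul_sq_pos (P : IsProfile d V φ k) (hr : r ∈ Ioc (0 : ℝ) 1) : 0 < r ^ d * φ r ^ 2 :=
  mul_pos (pow_pos hr.1 d) (pow_pos (P.pos r (Ioc_subset_Icc_self hr)) 2)

theorem hasDerivAt_profileTail (P : IsProfile d V φ k) (hr : r ∈ Ioc (0 : ℝ) 1) :
    HasDerivAt (profileTail d φ) (-(r ^ d * φ r ^ 2)⁻¹) r := by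
  have hφ := P.continuous
  have hw : Continuous fun t => t ^ d * φ t ^ 2 := by fun_prop
  refine intervalIntegral.integral_hasDerivAt_left (ContinuousOn.intervalIntegrable ?_)
    (hw.measurable.inv.stronglyMeasurable.stronglyMeasurableAtFilter)
    (hw.continuousAt.inv₀ (P.pow_mul_sq_pos hr).ne')
  rw [uIcc_of_le hr.2]
  exact hw.continuousOn.inv₀ fun t ht => (P.pow_mul_sq_pos ⟨hr.1.trans_le ht.1, ht.2⟩).ne'

theorem profileTail_nonneg (P : IsProfile d V φ k) (hr : r ∈ Ioc (0 : ℝ) 1) :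
    0 ≤ profileTail d φ r :=
  intervalIntegral.integral_nonneg hr.2 fun _ ht =>
    inv_nonneg.2 (P.pow_mul_sq_pos ⟨hr.1.trans_le ht.1, ht.2⟩).le

theorem outerSol_pos (P : IsProfile d V φ k) (hr : r ∈ Ioc (0 : ℝ) 1) : 0 < outerSol d φ r :=
  mul_pos (P.pos r (Ioc_subset_Icc_self hr))
    (add_pos_of_pos_of_nonneg (one_div_pos.2 P.deriv_one_pos) (P.profileTail_nonneg hr))

theorem outerSol_one (P : IsProfile d V φ k) : outerSol d φ 1 = 1 / deriv φ 1 := by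
  rw [outerSol, profileTail_one, P.one, one_mul, add_zero]

theorem hasDerivAt_outerSol (P : IsProfile d V φ k) (hr : r ∈ Ioc (0 : ℝ) 1) :
    HasDerivAt (outerSol d φ) (deriv φ r / φ r * outerSol d φ r - (r ^ d * φ r)⁻¹) r := by
  have hφ := (P.pos r (Ioc_subset_Icc_self hr)).ne'
  have hr0 := hr.1.ne'
  refine ((P.hasDerivAt r).mul ((P.hasDerivAt_profileTail hr).const_add _)).congr_deriv ?_
  unfold outerSol
  field_simp
  ring

theorem continuousOn_outerSol (P : IsProfile d V φ k) : ContinuousOn (outerSol d φ) (Ioc 0 1) :=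
  fun _ hr => (P.hasDerivAt_outerSol hr).continuousAt.continuousWithinAt

theorem deriv_outerSol_one (P : IsProfile d V φ k) : deriv (outerSol d φ) 1 = 0 := by
  rw [(P.hasDerivAt_outerSol ⟨zero_lt_one, le_rfl⟩).deriv, P.outerSol_one, P.one, one_pow, div_one,
    mul_one_div_cancel P.deriv_one_pos.ne', mul_one, inv_one, sub_self]

theorem radWronskian_outerSol (P : IsProfile d V φ k) (hr : r ∈ Ioc (0 : ℝ) 1) :
    radWronskian d φ (outerSol d φ) r = 1 := by
  have hφ := (P.pos r (Ioc_subset_Icc_self hr)).ne'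
  have hr0 := hr.1.ne'
  rw [radWronskian, (P.hasDerivAt_outerSol hr).deriv]
  field_simp
  ring

theorem isRadialSolution_outerSol (P : IsProfile d V φ k) :
    IsRadialSolution d V (outerSol d φ) (Ioo 0 1) where
  hasDerivAt r hr := by
    have h := P.hasDerivAt_outerSol (Ioo_subset_Ioc_self hr)
    rwa [h.deriv]
  hasDerivAt_deriv r hr := by
    have hφ := (P.pos r (Ioo_subset_Icc_self hr)).ne'
    have hr0 := hr.1.ne'
    have hψ := P.hasDerivAt_outerSol (Ioo_subset_Ioc_self hr)
    have hder : deriv (outerSol d φ) =ᶠ[𝓝 r]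
        fun r => deriv φ r / φ r * outerSol d φ r - (r ^ d * φ r)⁻¹ := by
      filter_upwards [isOpen_Ioo.mem_nhds hr] with t ht
      exact (P.hasDerivAt_outerSol (Ioo_subset_Ioc_self ht)).deriv
    refine HasDerivAt.congr_of_eventuallyEq ?_ hder
    have h1 := ((P.isRadialSolution.hasDerivAt_deriv r hr).div (P.hasDerivAt r) hφ).mul hψ
    have h2 := ((hasDerivAt_pow d r).mul (P.hasDerivAt r)).inv (mul_ne_zero (pow_ne_zero _ hr0) hφ)
    refine (h1.sub h2).congr_deriv ?_
    rw [hψ.deriv]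
    rcases d with _ | e
    · simp only [Pi.mul_apply, Pi.div_apply, pow_zero, Nat.cast_zero]
      field_simp
      ring
    · simp only [Pi.mul_apply, Pi.div_apply, Nat.add_sub_cancel, pow_succ]
      field_simp
      ring

theorem tendsto_radialGreen_one (P : IsProfile d V φ k) (hr : r ∈ Icc (0 : ℝ) 1) :
    Tendsto (radialGreen d φ r) (𝓝[<] 1) (𝓝 (radialGreen d φ r 1)) := by
  have hφ := P.continuous
  have hψ : ContinuousAt (outerSol d φ) (max r 1) := by
    rw [max_eq_right hr.2]
    exact (P.hasDerivAt_outerSol ⟨zero_lt_one, le_rfl⟩).continuousAt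
  have hψmax : ContinuousAt (fun s => outerSol d φ (max r s)) 1 :=
    ContinuousAt.comp (f := fun s => max r s) (x := (1 : ℝ)) hψ (by fun_prop)
  have hG : ContinuousAt (radialGreen d φ r) 1 :=
    ContinuousAt.mul (by fun_prop) (ContinuousAt.mul (by fun_prop) hψmax)
  exact hG.tendsto.mono_left nhdsWithin_le_nhds

theorem continuousOn_radialGreen (P : IsProfile d V φ k) (hs : s ∈ Ioo (0 : ℝ) 1) :
    ContinuousOn (radialGreen d φ · s) (Icc 0 1) := by
  have hφ := P.continuous
  have hψ : ContinuousOn (fun r => outerSol d φ (max r s)) (Icc 0 1) :=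
    P.continuousOn_outerSol.comp (by fun_prop) fun r hr =>
      ⟨hs.1.trans_le (le_max_right _ _), max_le hr.2 hs.2.le⟩
  exact continuousOn_const.mul (ContinuousOn.mul (by fun_prop) hψ)

theorem contDiffOn_radialGreen (P : IsProfile d V φ k) (hV : ContinuousOn V (Icc 0 1)) :
    ContDiffOn ℝ 2 (radialGreen d φ · s) (Ioo 0 1 \ {s}) := by
  have hV' := hV.mono Ioo_subset_Icc_self
  rintro r ⟨hr, hrs⟩
  have hnhds := isOpen_Ioo.mem_nhds hr
  refine ContDiffAt.contDiffWithinAt ?_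
  rcases lt_or_gt_of_ne hrs with h | h
  · have hφ := P.isRadialSolution.contDiffOn isOpen_Ioo left_notMem_Ioo hV'
    exact (contDiffAt_const.mul (hφ.contDiffAt hnhds)).congr_of_eventuallyEq
      (radialGreen_eventuallyEq_of_lt h)
  · have hψ := P.isRadialSolution_outerSol.contDiffOn isOpen_Ioo left_notMem_Ioo hV'
    exact (contDiffAt_const.mul (hψ.contDiffAt hnhds)).congr_of_eventuallyEq
      (radialGreen_eventuallyEq_of_gt h)

theorem radialGreen_equation (P : IsProfile d V φ k) (hr : r ∈ Ioo (0 : ℝ) 1 \ {s}) :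
    -deriv (deriv (radialGreen d φ · s)) r - d / r * deriv (radialGreen d φ · s) r
      + V r * radialGreen d φ r s = 0 := by
  rcases lt_or_gt_of_ne hr.2 with h | h
  · exact P.isRadialSolution.equation_of_eventuallyEq hr.1 (radialGreen_eventuallyEq_of_lt h)
  · exact P.isRadialSolution_outerSol.equation_of_eventuallyEq hr.1
      (radialGreen_eventuallyEq_of_gt h)

theorem tendsto_deriv_radialGreen_left (P : IsProfile d V φ k) :
    Tendsto (deriv (radialGreen d φ · s)) (𝓝[<] s) (𝓝 (s ^ d * outerSol d φ s * deriv φ s)) := by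
  have hlim := (P.continuous_deriv.tendsto s).const_mul (s ^ d * outerSol d φ s)
  refine (hlim.mono_left nhdsWithin_le_nhds).congr' ?_
  filter_upwards [self_mem_nhdsWithin] with t ht
  rw [(radialGreen_eventuallyEq_of_lt ht).deriv_eq, deriv_const_mul_field]

theorem tendsto_deriv_radialGreen_right (P : IsProfile d V φ k) (hs : s ∈ Ioo (0 : ℝ) 1) :
    Tendsto (deriv (radialGreen d φ · s)) (𝓝[>] s)
      (𝓝 (s ^ d * φ s * deriv (outerSol d φ) s)) := by
  have hlim := (P.isRadialSolution_outerSol.hasDerivAt_deriv s hs).continuousAt.tendsto.const_mul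
    (s ^ d * φ s)
  refine (hlim.mono_left nhdsWithin_le_nhds).congr' ?_
  filter_upwards [self_mem_nhdsWithin] with t ht
  rw [(radialGreen_eventuallyEq_of_gt ht).deriv_eq, deriv_const_mul_field]

theorem isNeumannGreen_radialGreen (P : IsProfile d V φ k) (hV : ContinuousOn V (Icc 0 1)) :
    IsNeumannGreen (d + 1) V (radialGreen d φ) where
  continuousOn _ hs := P.continuousOn_radialGreen hs
  contDiffOn _ _ := P.contDiffOn_radialGreen hV
  equation s _ r hr := by
    rw [Nat.cast_add_one, add_sub_cancel_right]
    exact P.radialGreen_equation hr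
  jump s hs := by
    refine ⟨_, _, P.tendsto_deriv_radialGreen_left, P.tendsto_deriv_radialGreen_right hs, ?_⟩
    have hW := P.radWronskian_outerSol (Ioo_subset_Ioc_self hs)
    rw [radWronskian] at hW
    linarith
  deriv_zero s hs := by
    have h := ((P.hasDerivAt 0).const_mul (s ^ d * outerSol d φ s)).congr_of_eventuallyEq
      (radialGreen_eventuallyEq_of_lt hs.1)
    rw [P.deriv_zero, mul_zero] at h
    exact h.hasDerivWithinAt
  deriv_one s hs := by
    have hψ := (P.hasDerivAt_outerSol ⟨zero_lt_one, le_rfl⟩).differentiableAt.hasDerivAt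
    have h := (hψ.const_mul (s ^ d * φ s)).congr_of_eventuallyEq
      (radialGreen_eventuallyEq_of_gt hs.2)
    rw [P.deriv_outerSol_one, mul_zero] at h
    exact h.hasDerivWithinAt
  tendsto_one _ hr := P.tendsto_radialGreen_one hr

end IsProfile

theorem le_abs_of_forall_le_abs_deriv {f : ℝ → ℝ} {a b m C : ℝ} (hab : a < b)
    (hfa : HasDerivWithinAt f m (Icc a b) a) (hfc : ContinuousOn f (Icc a b))
    (hfd : DifferentiableOn ℝ f (Ioo a b)) (hC : ∀ x ∈ Ioo a b, C ≤ |deriv f x|) : C ≤ |m| := by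
  have hslope : Tendsto (fun x => |slope f a x|) (𝓝[>] a) (𝓝 |m|) := by
    have h := hasDerivWithinAt_iff_tendsto_slope.1 hfa
    rw [Icc_sdiff_left, nhdsWithin_Ioc_eq_nhdsGT hab] at h
    exact h.abs
  refine ge_of_tendsto hslope ?_
  filter_upwards [Ioo_mem_nhdsGT hab] with x hx
  obtain ⟨y, hy, hyx⟩ := exists_deriv_eq_slope f hx.1
    (hfc.mono (Icc_subset_Icc_right hx.2.le)) (hfd.mono (Ioo_subset_Ioo_right hx.2.le))
  rw [slope_def_field, ← hyx]
  exact hC y ⟨hy.1, hy.2.trans hx.2⟩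

theorem exists_forall_eq_of_hasDerivAt_zero {f : ℝ → ℝ} {a b : ℝ}
    (hf : ∀ r ∈ Ioo a b, HasDerivAt f 0 r) : ∃ c, ∀ r ∈ Ioo a b, f r = c :=
  isOpen_Ioo.exists_is_const_of_deriv_eq_zero isPreconnected_Ioo
    (fun r hr => (hf r hr).differentiableAt.differentiableWithinAt) fun r hr => (hf r hr).deriv

theorem isLocalMinOn_of_tendsto_deriv_neg {f : ℝ → ℝ} {a b m : ℝ} (hab : a < b)
    (hf : ContinuousOn f (Ioc a b)) (hm : Tendsto (deriv f) (𝓝[<] b) (𝓝 m)) (hneg : m < 0) :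
    IsLocalMinOn f (Ioc a b) b := by
  obtain ⟨c, hcb, hc⟩ := mem_nhdsLT_iff_exists_Ioo_subset.1
    ((hm.eventually_lt_const hneg).and (Ioo_mem_nhdsLT hab))
  have hac : ∀ x ∈ Ioc c b, a < x := fun x hx => hx.2.eq_or_lt.elim (fun h => h ▸ hab)
    fun h => (hc ⟨hx.1, h⟩).2.1
  have hanti : AntitoneOn f (Ioc c b) := by
    refine antitoneOn_of_deriv_nonpos (convex_Ioc c b) (hf.mono fun x hx => ⟨hac x hx, hx.2⟩)
      (fun x hx => ?_) fun x hx => ?_ <;> rw [interior_Ioc] at hx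
    · exact (differentiableAt_of_deriv_ne_zero (hc hx).1.ne).differentiableWithinAt
    · exact (hc hx).1.le
  filter_upwards [self_mem_nhdsWithin, nhdsWithin_le_nhds (lt_mem_nhds hcb)] with x hx hcx
  exact hanti ⟨hcx, hx.2⟩ ⟨hcb, le_rfl⟩ hx.2

namespace IsProfile

variable {d : ℕ} {V φ k g : ℝ → ℝ} {x y s : ℝ}

theorem hasDerivAt_radWronskian_zero (P : IsProfile d V φ k)
    (S : IsRadialSolution d V g (Ioo x y)) (hxy : Ioo x y ⊆ Ioo 0 1) {r : ℝ} (hr : r ∈ Ioo x y) :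
    HasDerivAt (radWronskian d φ g) 0 r := by
  have hr0 := (hxy hr).1.ne'
  have h := ((S.hasDerivAt r hr).mul (P.isRadialSolution.hasDerivAt_deriv r (hxy hr))).sub
    ((S.hasDerivAt_deriv r hr).mul (P.hasDerivAt r))
  refine ((hasDerivAt_pow d r).mul h).congr_deriv ?_
  rcases d with _ | e
  · simp only [Pi.sub_apply, Pi.mul_apply, pow_zero, Nat.cast_zero]
    ring
  · simp only [Pi.sub_apply, Pi.mul_apply, Nat.add_sub_cancel, pow_succ]
    field_simp
    ring

/-- A constant Wronskian `c` makes `(g / φ)' = -c / (r ^ d φ ^ 2)`, which is `c` times the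
derivative of `profileTail`. -/
theorem exists_div_eq (P : IsProfile d V φ k) (S : IsRadialSolution d V g (Ioo x y))
    (hxy : Ioo x y ⊆ Ioo 0 1) :
    ∃ c K, ∀ r ∈ Ioo x y, g r / φ r = K + c * profileTail d φ r := by
  obtain ⟨c, hc⟩ := exists_forall_eq_of_hasDerivAt_zero fun r hr =>
    P.hasDerivAt_radWronskian_zero S hxy hr
  have hconst : ∀ r ∈ Ioo x y, HasDerivAt (fun r => g r / φ r - c * profileTail d φ r) 0 r := by
    intro r hr
    have hr0 := (hxy hr).1.ne'
    have hφ := (P.pos r (Ioo_subset_Icc_self (hxy hr))).ne'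
    refine (((S.hasDerivAt r hr).div (P.hasDerivAt r) hφ).sub
      ((P.hasDerivAt_profileTail (Ioo_subset_Ioc_self (hxy hr))).const_mul c)).congr_deriv ?_
    rw [← hc r hr, radWronskian]
    field_simp
    ring
  obtain ⟨K, hK⟩ := exists_forall_eq_of_hasDerivAt_zero hconst
  exact ⟨c, K, fun r hr => by linarith [hK r hr]⟩

/-- If `g / φ = K + c * profileTail d φ`, then `|(g / φ)'| ≥ |c|` on `(0, s)`, while
`(g / φ)'(0) = 0`. -/
theorem exists_eq_mul_of_deriv_zero (P : IsProfile d V φ k) (hs : s ∈ Ioo (0 : ℝ) 1)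
    (S : IsRadialSolution d V g (Ioo 0 s)) (hgc : ContinuousOn g (Icc 0 s))
    (hg0 : HasDerivWithinAt g 0 (Icc 0 s) 0) : ∃ A, ∀ r ∈ Icc 0 s, g r = A * φ r := by
  have hsub : Icc 0 s ⊆ Icc (0 : ℝ) 1 := Icc_subset_Icc_right hs.2.le
  have hφ : ∀ r ∈ Icc 0 s, φ r ≠ 0 := fun r hr => (P.pos r (hsub hr)).ne'
  obtain ⟨c, K, hK⟩ := P.exists_div_eq S (Ioo_subset_Ioo_right hs.2.le)
  have hqc : ContinuousOn (fun r => g r / φ r) (Icc 0 s) := hgc.div P.continuous.continuousOn hφ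
  have hq : ∀ r ∈ Ioo 0 s, HasDerivAt (fun r => g r / φ r) (c * -(r ^ d * φ r ^ 2)⁻¹) r := by
    intro r hr
    refine (((P.hasDerivAt_profileTail ⟨hr.1, hr.2.le.trans hs.2.le⟩).const_mul c).const_add
      K).congr_of_eventuallyEq ?_
    filter_upwards [isOpen_Ioo.mem_nhds hr] using hK
  have hc : |c| ≤ |(0 : ℝ)| := by
    have hq0 : HasDerivWithinAt (fun r => g r / φ r) 0 (Icc 0 s) 0 := by
      have h := hg0.div (P.hasDerivAt 0).hasDerivWithinAt P.zero_pos.ne'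
      rwa [P.deriv_zero, zero_mul, mul_zero, sub_zero, zero_div] at h
    refine le_abs_of_forall_le_abs_deriv hs.1 hq0 hqc
      (fun r hr => (hq r hr).differentiableAt.differentiableWithinAt) fun r hr => ?_
    have hr1 : r ∈ Ioc (0 : ℝ) 1 := ⟨hr.1, hr.2.le.trans hs.2.le⟩
    rw [(hq r hr).deriv, abs_mul, abs_neg, abs_of_pos (inv_pos.2 (P.pow_mul_sq_pos hr1))]
    refine le_mul_of_one_le_right (abs_nonneg c) (one_le_inv₀ (P.pow_mul_sq_pos hr1) |>.2 ?_)
    exact mul_le_one₀ (pow_le_one₀ hr1.1.le hr1.2) (sq_nonneg _)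
      (pow_le_one₀ (P.pos r (hsub ⟨hr.1.le, hr.2.le⟩)).le (P.le_one ⟨hr1.1.le, hr1.2⟩))
  have hEq : EqOn (fun r => g r / φ r) (fun _ => K) (Icc 0 s) := by
    refine EqOn.of_subset_closure (fun r hr => ?_) hqc continuousOn_const Ioo_subset_Icc_self
      (closure_Ioo hs.1.ne).ge
    rw [hK r hr, abs_eq_zero.1 (le_antisymm (hc.trans_eq abs_zero) (abs_nonneg c)), zero_mul,
      add_zero]
  exact ⟨K, fun r hr => (div_eq_iff (hφ r hr)).1 (hEq hr)⟩

theorem exists_eq_mul_outerSol_of_deriv_zero (P : IsProfile d V φ k) (hs : s ∈ Ioo (0 : ℝ) 1)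
    (S : IsRadialSolution d V g (Ioo s 1)) (hgc : ContinuousOn g (Icc s 1))
    (hg1 : HasDerivWithinAt g 0 (Icc s 1) 1) :
    ∃ B, ∀ r ∈ Icc s 1, g r = B * outerSol d φ r := by
  have hsub : Icc s 1 ⊆ Ioc (0 : ℝ) 1 := fun r hr => ⟨hs.1.trans_le hr.1, hr.2⟩
  have hφ : ∀ r ∈ Icc s 1, φ r ≠ 0 := fun r hr => (P.pos r (Ioc_subset_Icc_self (hsub hr))).ne'
  have h1 : (1 : ℝ) ∈ Icc s 1 := ⟨hs.2.le, le_rfl⟩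
  obtain ⟨c, K, hK⟩ := P.exists_div_eq S (Ioo_subset_Ioo_left hs.1.le)
  have hτ : ContinuousOn (profileTail d φ) (Icc s 1) := fun r hr =>
    (P.hasDerivAt_profileTail (hsub hr)).continuousAt.continuousWithinAt
  have hEq : EqOn (fun r => g r / φ r) (fun r => K + c * profileTail d φ r) (Icc s 1) :=
    EqOn.of_subset_closure (s := Ioo s 1) hK (hgc.div P.continuous.continuousOn hφ)
      (continuousOn_const.add (continuousOn_const.mul hτ)) Ioo_subset_Icc_self
      (closure_Ioo hs.2.ne).ge
  have hg : ∀ r ∈ Icc s 1, g r = (K + c * profileTail d φ r) * φ r := fun r hr =>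
    (div_eq_iff (hφ r hr)).1 (hEq hr)
  have hder := ((P.hasDerivAt_profileTail (hsub h1)).const_mul c |>.const_add K).mul
    (P.hasDerivAt 1)
  have hcK := (uniqueDiffOn_Icc hs.2 1 h1).eq_deriv _ hg1
    (hder.hasDerivWithinAt.congr hg (hg 1 h1))
  simp only [P.one, profileTail_one, one_pow, mul_one, inv_one, mul_zero, add_zero] at hcK
  refine ⟨c, fun r hr => ?_⟩
  have hm := P.deriv_one_pos.ne'
  have hKc : K = c / deriv φ 1 := by rw [eq_div_iff hm]; linarith
  rw [hg r hr, outerSol, hKc]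
  ring

theorem green_coeff_eq (P : IsProfile d V φ k) (hs : s ∈ Ioo (0 : ℝ) 1) {A B : ℝ}
    (hmatch : A * φ s = B * outerSol d φ s)
    (hjump : B * deriv (outerSol d φ) s - A * deriv φ s = -1) :
    A = s ^ d * outerSol d φ s ∧ B = s ^ d * φ s := by
  have hW := P.radWronskian_outerSol (Ioo_subset_Ioc_self hs)
  rw [radWronskian] at hW
  have hB : B = s ^ d * φ s := by
    linear_combination (-B) * hW + s ^ d * (-φ s) * hjump + s ^ d * (-deriv φ s) * hmatch
  refine ⟨mul_right_cancel₀ (P.pos s (Ioo_subset_Icc_self hs)).ne' ?_, hB⟩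
  rw [hmatch, hB]
  ring

end IsProfile

theorem tendsto_deriv_of_eqOn {f g : ℝ → ℝ} {U : Set ℝ} {l : Filter ℝ} {m : ℝ} (hU : IsOpen U)
    (hl : U ∈ l) (heq : EqOn f g U) (hg : Tendsto (deriv g) l (𝓝 m)) :
    Tendsto (deriv f) l (𝓝 m) :=
  hg.congr' (by filter_upwards [hl] with x hx using (heq.deriv hU hx).symm)

namespace IsNeumannGreen

variable {d : ℕ} {V φ k : ℝ → ℝ} {G : ℝ → ℝ → ℝ} {r s : ℝ}

theorem isRadialSolution (hG : IsNeumannGreen (d + 1) V G) (hs : s ∈ Ioo (0 : ℝ) 1) {U : Set ℝ}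
    (hU : IsOpen U) (hsub : U ⊆ Ioo 0 1 \ {s}) : IsRadialSolution d V (G · s) U :=
  .of_contDiffOn hU ((hG.contDiffOn s hs).mono hsub) fun r hr => by
    have h := hG.equation s hs r (hsub hr)
    rwa [Nat.cast_add_one, add_sub_cancel_right] at h

theorem eq_radialGreen_of_lt_one (hG : IsNeumannGreen (d + 1) V G) (P : IsProfile d V φ k)
    (hr : r ∈ Icc (0 : ℝ) 1) (hs : s ∈ Ioo (0 : ℝ) 1) : G r s = radialGreen d φ r s := by
  have hLsub : Icc 0 s ⊆ Icc (0 : ℝ) 1 := Icc_subset_Icc_right hs.2.le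
  have hRsub : Icc s 1 ⊆ Icc (0 : ℝ) 1 := Icc_subset_Icc_left hs.1.le
  obtain ⟨A, hA⟩ := P.exists_eq_mul_of_deriv_zero hs
    (hG.isRadialSolution hs isOpen_Ioo fun t ht => ⟨⟨ht.1, ht.2.trans hs.2⟩, ht.2.ne⟩)
    ((hG.continuousOn s hs).mono hLsub) ((hG.deriv_zero s hs).mono hLsub)
  obtain ⟨B, hB⟩ := P.exists_eq_mul_outerSol_of_deriv_zero hs
    (hG.isRadialSolution hs isOpen_Ioo fun t ht => ⟨⟨hs.1.trans ht.1, ht.2⟩, ht.1.ne'⟩)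
    ((hG.continuousOn s hs).mono hRsub) ((hG.deriv_one s hs).mono hRsub)
  obtain ⟨a, b, ha, hb, hab⟩ := hG.jump s hs
  have ha' : a = A * deriv φ s := by
    refine tendsto_nhds_unique ha (tendsto_deriv_of_eqOn isOpen_Ioo (Ioo_mem_nhdsLT hs.1)
      (fun t ht => hA t (Ioo_subset_Icc_self ht)) ?_)
    rw [deriv_const_mul_field']
    exact ((P.continuous_deriv.tendsto s).const_mul A).mono_left nhdsWithin_le_nhds
  have hb' : b = B * deriv (outerSol d φ) s := by
    refine tendsto_nhds_unique hb (tendsto_deriv_of_eqOn isOpen_Ioo (Ioo_mem_nhdsGT hs.2)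
      (fun t ht => hB t (Ioo_subset_Icc_self ht)) ?_)
    rw [deriv_const_mul_field']
    have hψ := (P.isRadialSolution_outerSol.hasDerivAt_deriv s hs).continuousAt.tendsto
    exact (hψ.const_mul B).mono_left nhdsWithin_le_nhds
  obtain ⟨hAs, hBs⟩ := P.green_coeff_eq hs
    ((hA s ⟨hs.1.le, le_rfl⟩).symm.trans (hB s ⟨le_rfl, hs.2.le⟩)) (by rw [← ha', ← hb', hab])
  rcases le_total r s with h | h
  · rw [hA r ⟨hr.1, h⟩, radialGreen_of_le h, hAs]
  · rw [hB r ⟨h, hr.2⟩, radialGreen_of_ge h, hBs]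

theorem eq_radialGreen (hG : IsNeumannGreen (d + 1) V G) (P : IsProfile d V φ k)
    (hr : r ∈ Icc (0 : ℝ) 1) (hs : s ∈ Ioc (0 : ℝ) 1) : G r s = radialGreen d φ r s := by
  rcases hs.2.eq_or_lt with rfl | hlt
  · refine tendsto_nhds_unique (hG.tendsto_one r hr) ((P.tendsto_radialGreen_one hr).congr' ?_)
    filter_upwards [Ioo_mem_nhdsLT zero_lt_one] with t ht
    exact (hG.eq_radialGreen_of_lt_one P hr ht).symm
  · exact hG.eq_radialGreen_of_lt_one P hr ⟨hs.1, hlt⟩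

theorem apply_one_div (hG : IsNeumannGreen (d + 1) V G) (P : IsProfile d V φ k)
    (hr : r ∈ Icc (0 : ℝ) 1) : G r 1 / G 1 1 = φ r := by
  have h1 : (1 : ℝ) ∈ Ioc (0 : ℝ) 1 := ⟨zero_lt_one, le_rfl⟩
  rw [hG.eq_radialGreen P hr h1, hG.eq_radialGreen P ⟨zero_le_one, le_rfl⟩ h1,
    radialGreen_of_le hr.2, radialGreen_of_le le_rfl, one_pow, one_mul, P.one, mul_one,
    mul_div_cancel_left₀ _ (P.outerSol_pos h1).ne']

theorem diag_eq (hG : IsNeumannGreen (d + 1) V G) (P : IsProfile d V φ k)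
    (hr : r ∈ Ioc (0 : ℝ) 1) : G r r = r ^ d * (φ r * outerSol d φ r) := by
  rw [hG.eq_radialGreen P (Ioc_subset_Icc_self hr) hr, radialGreen, min_self, max_self]

theorem diag_pos (hG : IsNeumannGreen (d + 1) V G) (P : IsProfile d V φ k)
    (hr : r ∈ Ioc (0 : ℝ) 1) : 0 < G r r := by
  rw [hG.diag_eq P hr]
  exact mul_pos (pow_pos hr.1 _) (mul_pos (P.pos r (Ioc_subset_Icc_self hr)) (P.outerSol_pos hr))

theorem energyF_eq (hG : IsNeumannGreen (d + 1) V G) (P : IsProfile d V φ k) :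
    EqOn (energyF (d + 1) G) (fun r => sphereArea (d + 1) / (φ r * outerSol d φ r)) (Ioc 0 1) := by
  intro r hr
  rw [energyF, hG.diag_eq P hr, Nat.add_sub_cancel, mul_comm, mul_div_mul_left]
  exact (pow_pos hr.1 d).ne'

end IsNeumannGreen

theorem sphereArea_pos (d : ℕ) : 0 < sphereArea (d + 1) := by
  rw [sphereArea, Measure.toSphere_real_apply_univ, finrank_euclideanSpace_fin]
  exact mul_pos (Nat.cast_pos.2 d.succ_pos) (ENNReal.toReal_pos
    (measure_ball_pos volume _ zero_lt_one).ne' measure_ball_lt_top.ne)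

namespace IsProfile

variable {d : ℕ} {V φ k : ℝ → ℝ} {r : ℝ}

/-- The Wronskian identity turns `(φ ψ)'` into `2 φ' ψ - r ^ (-d)`. -/
theorem hasDerivAt_const_div_mul_outerSol (P : IsProfile d V φ k) (hr : r ∈ Ioc (0 : ℝ) 1)
    (C : ℝ) : HasDerivAt (fun r => C / (φ r * outerSol d φ r))
      (C * ((r ^ d)⁻¹ - 2 * (deriv φ r * outerSol d φ r)) / (φ r * outerSol d φ r) ^ 2) r := by
  have hφ := P.pos r (Ioc_subset_Icc_self hr)
  have hψ := P.outerSol_pos hr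
  have hr0 := hr.1.ne'
  refine ((hasDerivAt_const r C).div
    ((P.hasDerivAt r).mul (P.hasDerivAt_outerSol hr)) (mul_pos hφ hψ).ne').congr_deriv ?_
  simp only [Pi.mul_apply]
  field_simp
  ring

theorem tendsto_deriv_const_div_mul_outerSol (P : IsProfile d V φ k) (C : ℝ) :
    Tendsto (deriv fun r => C / (φ r * outerSol d φ r)) (𝓝[<] 1) (𝓝 (-(C * deriv φ 1 ^ 2))) := by
  have h1 : (1 : ℝ) ∈ Ioc (0 : ℝ) 1 := ⟨zero_lt_one, le_rfl⟩
  have hm := P.deriv_one_pos.ne'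
  have hφ := P.continuous
  have hφ' := P.continuous_deriv
  have hψ : ContinuousAt (outerSol d φ) 1 := (P.hasDerivAt_outerSol h1).continuousAt
  have hpow : ContinuousAt (fun r : ℝ => (r ^ d)⁻¹) 1 := ContinuousAt.inv₀ (by fun_prop) (by simp)
  have hlim : ContinuousAt (fun r => C * ((r ^ d)⁻¹ - 2 * (deriv φ r * outerSol d φ r))
      / (φ r * outerSol d φ r) ^ 2) 1 := by
    refine ContinuousAt.div (by fun_prop) (by fun_prop) (pow_ne_zero 2 ?_)
    exact (mul_pos (P.pos 1 (Ioc_subset_Icc_self h1)) (P.outerSol_pos h1)).ne'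
  have hval : C * (((1 : ℝ) ^ d)⁻¹ - 2 * (deriv φ 1 * outerSol d φ 1))
      / (φ 1 * outerSol d φ 1) ^ 2 = -(C * deriv φ 1 ^ 2) := by
    rw [P.one, P.outerSol_one, one_pow]
    field_simp
    ring
  refine (hval ▸ hlim.tendsto.mono_left nhdsWithin_le_nhds).congr' ?_
  filter_upwards [Ioo_mem_nhdsLT zero_lt_one] with r hr
  exact (P.hasDerivAt_const_div_mul_outerSol (Ioo_subset_Ioc_self hr) C).deriv.symm

end IsProfile

namespace IsNeumannGreen

variable {d : ℕ} {V φ k : ℝ → ℝ} {G : ℝ → ℝ → ℝ}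

theorem exists_tendsto_deriv_energyF (hG : IsNeumannGreen (d + 1) V G) (P : IsProfile d V φ k) :
    ∃ ℓ < 0, Tendsto (deriv (energyF (d + 1) G)) (𝓝[<] 1) (𝓝 ℓ) :=
  ⟨_, neg_neg_of_pos (mul_pos (sphereArea_pos d) (pow_pos P.deriv_one_pos 2)),
    tendsto_deriv_of_eqOn isOpen_Ioo (Ioo_mem_nhdsLT zero_lt_one)
      ((hG.energyF_eq P).mono Ioo_subset_Ioc_self) (P.tendsto_deriv_const_div_mul_outerSol _)⟩

theorem isLocalMinOn_energyF (hG : IsNeumannGreen (d + 1) V G) (P : IsProfile d V φ k) :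
    IsLocalMinOn (energyF (d + 1) G) (Ioc 0 1) 1 := by
  obtain ⟨ℓ, hneg, hℓ⟩ := hG.exists_tendsto_deriv_energyF P
  refine isLocalMinOn_of_tendsto_deriv_neg zero_lt_one ?_ hℓ hneg
  refine ContinuousOn.congr (fun r hr => ?_) (hG.energyF_eq P)
  exact (P.hasDerivAt_const_div_mul_outerSol hr _).continuousAt.continuousWithinAt

end IsNeumannGreen

section Gradient

variable {E : Type*} [NormedAddCommGroup E] [InnerProductSpace ℝ E]

theorem hasGradientAt_norm [CompleteSpace E] {x : E} (hx : x ≠ 0) :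
    HasGradientAt (fun y : E => ‖y‖) (‖x‖⁻¹ • x) x := by
  have hsqrt := ((hasFDerivAt_id x).norm_sq).sqrt (by simpa using hx)
  simp only [id, Real.sqrt_sq (norm_nonneg _)] at hsqrt
  refine hsqrt.congr_fderiv ?_
  ext y
  simp only [smul_apply, ContinuousLinearMap.comp_apply, smul_eq_mul, innerSL_apply_apply,
    ContinuousLinearMap.id_apply, InnerProductSpace.toDual_apply_apply, real_inner_smul_left,
    nsmul_eq_mul, Nat.cast_ofNat]
  field_simp

variable [FiniteDimensional ℝ E] {f : E → ℝ} {X : E → E} {X' : E → E →L[ℝ] E}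

theorem contDiff_two_of_hasGradientAt (hf : ∀ x, HasGradientAt f (X x) x) (hX : ContDiff ℝ 1 X) :
    ContDiff ℝ 2 f := by
  rw [← one_add_one_eq_two, contDiff_succ_iff_fderiv_apply]
  refine ⟨fun x => (hf x).differentiableAt, by simp, fun y => ?_⟩
  simp only [(hf _).fderiv_apply]
  exact hX.inner ℝ contDiff_const

theorem laplacian_eq_trace_of_hasGradientAt (hf : ∀ x, HasGradientAt f (X x) x)
    (hX : ∀ x, HasFDerivAt X (X' x) x) (x : E) :
    Laplacian.laplacian f x = LinearMap.trace ℝ E (X' x) := by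
  set b := stdOrthonormalBasis ℝ E
  rw [InnerProductSpace.laplacian_eq_iteratedFDeriv_orthonormalBasis f b,
    LinearMap.trace_eq_sum_inner _ b]
  refine Finset.sum_congr rfl fun i _ => ?_
  have hfderiv : fderiv ℝ f = (innerSL ℝ : E →L[ℝ] E →L[ℝ] ℝ) ∘ X :=
    funext fun y => (hf y).hasFDerivAt.fderiv
  rw [iteratedFDeriv_two_apply, hfderiv,
    ((innerSL ℝ : E →L[ℝ] E →L[ℝ] ℝ).hasFDerivAt.comp x (hX x)).fderiv]
  exact real_inner_comm _ _

end Gradient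

section RadialFunctions

variable {E : Type*} [NormedAddCommGroup E] [InnerProductSpace ℝ E] {d : ℕ} {u h : ℝ → ℝ}

/-- The gradient of `x ↦ u ‖x‖` for a radial function with Laplacian `x ↦ h ‖x‖`. -/
noncomputable def radField (d : ℕ) (h : ℝ → ℝ) (x : E) : E :=
  radAvg d h ‖x‖ • x

/-- The derivative of `radField`, that is, the Hessian of the radial function. -/
noncomputable def radFieldDeriv (d : ℕ) (h : ℝ → ℝ) (x : E) : E →L[ℝ] E :=
  radAvg d h ‖x‖ • ContinuousLinearMap.id ℝ E +
    ((h ‖x‖ - (d + 1) * radAvg d h ‖x‖) / ‖x‖ ^ 2) • InnerProductSpace.rankOne ℝ x x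

theorem continuous_radField (hh : Continuous h) : Continuous (radField d h : E → E) :=
  ((continuous_radAvg hh).comp continuous_norm).smul continuous_id

theorem hasFDerivAt_radField_zero (hh : Continuous h) :
    HasFDerivAt (radField d h : E → E) (radFieldDeriv d h 0) 0 := by
  rw [hasFDerivAt_iff_isLittleO]
  have hc : Continuous fun y : E => radAvg d h ‖y‖ - radAvg d h 0 :=
    ((continuous_radAvg hh).comp continuous_norm).sub continuous_const
  have hlim : Tendsto (fun y : E => radAvg d h ‖y‖ - radAvg d h 0) (𝓝 0) (𝓝 0) := by
    simpa using hc.tendsto 0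
  refine (((Asymptotics.isLittleO_one_iff ℝ).2 hlim).smul_isBigO
    (Asymptotics.isBigO_refl (fun y : E => y) (𝓝 0))).congr (fun y => ?_) fun y => ?_
  · simp [radField, radFieldDeriv, sub_smul]
  · simp

theorem hasFDerivAt_radField [CompleteSpace E] (hh : Continuous h) (x : E) :
    HasFDerivAt (radField d h : E → E) (radFieldDeriv d h x) x := by
  rcases eq_or_ne x 0 with rfl | hx
  · exact hasFDerivAt_radField_zero hh
  · have hx' : ‖x‖ ≠ 0 := norm_ne_zero_iff.2 hx
    have havg := (hasDerivAt_radAvg (d := d) hh hx').comp_hasFDerivAt x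
      (hasGradientAt_norm hx).hasFDerivAt
    refine (havg.fun_smul (hasFDerivAt_id x)).congr_fderiv ?_
    ext1 y
    simp only [radFieldDeriv, Function.comp_apply, add_apply, smul_apply,
      ContinuousLinearMap.smulRight_apply, ContinuousLinearMap.id_apply, id, smul_eq_mul,
      InnerProductSpace.toDual_apply_apply, real_inner_smul_left, InnerProductSpace.rankOne_apply,
      smul_smul]
    congr 2
    field_simp

theorem continuousAt_radFieldDeriv_zero (hh : Continuous h) :
    ContinuousAt (radFieldDeriv d h : E → E →L[ℝ] E) 0 := by
  have hA := continuous_radAvg (d := d) hh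
  have hc : Continuous fun x : E => |h ‖x‖ - (d + 1) * radAvg d h ‖x‖| := by fun_prop
  have hlim : Tendsto (fun x : E => |h ‖x‖ - (d + 1) * radAvg d h ‖x‖|) (𝓝 0) (𝓝 0) := by
    have h0 : (d : ℝ) + 1 ≠ 0 := by positivity
    simpa [radAvg_zero, mul_div_cancel₀, h0] using hc.tendsto 0
  refine ContinuousAt.add (by fun_prop) ?_
  rw [ContinuousAt, map_zero, smul_zero]
  refine squeeze_zero_norm (fun x => ?_) hlim
  rw [norm_smul, InnerProductSpace.norm_rankOne, norm_div, norm_pow, norm_norm, Real.norm_eq_abs,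
    ← sq, div_mul_eq_mul_div]
  exact div_le_of_le_mul₀ (by positivity) (abs_nonneg _) le_rfl

theorem continuous_radFieldDeriv (hh : Continuous h) :
    Continuous (radFieldDeriv d h : E → E →L[ℝ] E) := by
  refine continuous_iff_continuousAt.2 fun x => ?_
  rcases eq_or_ne x 0 with rfl | hx
  · exact continuousAt_radFieldDeriv_zero hh
  · have hA := continuous_radAvg (d := d) hh
    have hx' : ‖x‖ ^ 2 ≠ 0 := pow_ne_zero _ (norm_ne_zero_iff.2 hx)
    have hrank : Continuous fun x : E => InnerProductSpace.rankOne ℝ x x :=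
      (InnerProductSpace.rankOne ℝ).continuous.clm_apply continuous_id
    have hcoeff : ContinuousAt (fun x : E => (h ‖x‖ - (d + 1) * radAvg d h ‖x‖) / ‖x‖ ^ 2) x :=
      ContinuousAt.div (by fun_prop) (by fun_prop) hx'
    exact ContinuousAt.add (by fun_prop) (hcoeff.smul hrank.continuousAt)

theorem contDiff_one_radField [CompleteSpace E] (hh : Continuous h) :
    ContDiff ℝ 1 (radField d h : E → E) :=
  contDiff_one_iff_hasFDerivAt.2 ⟨_, continuous_radFieldDeriv hh, hasFDerivAt_radField hh⟩

theorem trace_radFieldDeriv [FiniteDimensional ℝ E] (hE : Module.finrank ℝ E = d + 1) (x : E) :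
    LinearMap.trace ℝ E (radFieldDeriv d h x) = h ‖x‖ := by
  rw [radFieldDeriv, ContinuousLinearMap.toLinearMap_add, ContinuousLinearMap.toLinearMap_smul,
    ContinuousLinearMap.toLinearMap_smul, map_add, map_smul, map_smul,
    InnerProductSpace.trace_rankOne, real_inner_self_eq_norm_sq, ContinuousLinearMap.coe_id,
    LinearMap.trace_id, hE, smul_eq_mul, smul_eq_mul]
  push_cast
  rcases eq_or_ne x 0 with rfl | hx
  · rw [norm_zero, radAvg_zero]
    field_simp
    simp
  · have hx' : ‖x‖ ≠ 0 := norm_ne_zero_iff.2 hx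
    field_simp
    ring

namespace HasRadialLaplacian

theorem hasGradientAt_comp_norm [CompleteSpace E] (U : HasRadialLaplacian d u h) (x : E) :
    HasGradientAt (fun y : E => u ‖y‖) (radField d h x) x := by
  rcases eq_or_ne x 0 with rfl | hx
  · have hzero := (U.hasDerivAt_mul_radAvg 0).isLittleO.comp_tendsto (tendsto_norm_zero (E := E))
    rw [hasGradientAt_iff_isLittleO]
    refine (hzero.congr (fun y => ?_) fun y => ?_).trans_isBigO
      (Asymptotics.isBigO_refl (fun y => ‖y - 0‖) _).of_norm_right
    all_goals simp [radField]
  · refine ((U.hasDerivAt_mul_radAvg ‖x‖).comp_hasFDerivAt x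
      (hasGradientAt_norm hx).hasFDerivAt).congr_fderiv ?_
    rw [radField, map_smul, map_smul, smul_smul]
    congr 1
    field_simp

variable [FiniteDimensional ℝ E]

theorem contDiff_two_comp_norm (U : HasRadialLaplacian d u h) :
    ContDiff ℝ 2 fun x : E => u ‖x‖ :=
  contDiff_two_of_hasGradientAt U.hasGradientAt_comp_norm
    (contDiff_one_radField U.continuous_source)

theorem laplacian_comp_norm (U : HasRadialLaplacian d u h) (hE : Module.finrank ℝ E = d + 1)
    (x : E) : Laplacian.laplacian (fun y : E => u ‖y‖) x = h ‖x‖ := by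
  rw [laplacian_eq_trace_of_hasGradientAt U.hasGradientAt_comp_norm
    (hasFDerivAt_radField U.continuous_source), trace_radFieldDeriv hE]

end HasRadialLaplacian

end RadialFunctions

section Lebesgue

variable {α F ι : Type*} [MeasurableSpace α] {μ : Measure α} [NormedAddCommGroup F]
  {l : Filter ι} {f : ι → α → F} {g : α → F} {s : Set α} {q : ℝ≥0∞}

theorem tendsto_eLpNorm_sub_of_tendstoUniformlyOn (hs : MeasurableSet s) (hμs : μ s ≠ ⊤)
    (hf : TendstoUniformlyOn f g l s) :
    Tendsto (fun i => eLpNorm (f i - g) q (μ.restrict s)) l (𝓝 0) := by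
  have hlim : Tendsto (fun ε : ℝ => μ s ^ q.toReal⁻¹ * ENNReal.ofReal ε) (𝓝[>] 0) (𝓝 0) := by
    have hofReal : Tendsto ENNReal.ofReal (𝓝[>] 0) (𝓝 0) := by
      simpa using (ENNReal.continuous_ofReal.tendsto 0).mono_left nhdsWithin_le_nhds
    simpa using ENNReal.Tendsto.const_mul hofReal
      (Or.inr (ENNReal.rpow_ne_top_of_nonneg (by positivity) hμs))
  rw [ENNReal.tendsto_nhds_zero]
  intro δ hδ
  obtain ⟨ε, hεδ, hε⟩ := ((hlim.eventually (gt_mem_nhds hδ)).and self_mem_nhdsWithin).exists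
  filter_upwards [Metric.tendstoUniformlyOn_iff.1 hf ε hε] with i hi
  have hle : ∀ᵐ x ∂μ.restrict s, ‖(f i - g) x‖ ≤ ε := by
    filter_upwards [ae_restrict_mem hs] with x hx
    simpa only [dist_eq_norm_sub', Pi.sub_apply] using (hi x hx).le
  refine (eLpNorm_le_of_ae_bound hle).trans ?_
  rw [Measure.restrict_apply_univ]
  exact hεδ.le

theorem tendsto_eLpNorm_zero_of_dominated [l.IsCountablyGenerated] {bound : α → ℝ} (hq : q ≠ ⊤)
    (hm : ∀ᶠ i in l, AEStronglyMeasurable (f i) μ) (hbound : MemLp bound q μ)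
    (hle : ∀ᶠ i in l, ∀ᵐ x ∂μ, ‖f i x‖ ≤ bound x)
    (hlim : ∀ᵐ x ∂μ, Tendsto (fun i => f i x) l (𝓝 0)) :
    Tendsto (fun i => eLpNorm (f i) q μ) l (𝓝 0) := by
  rcases eq_or_ne q 0 with rfl | hq0
  · simpa only [eLpNorm_exponent_zero] using tendsto_const_nhds
  have hqpos : 0 < q.toReal := ENNReal.toReal_pos hq0 hq
  have hint : Tendsto (fun i => ∫⁻ x, ‖f i x‖ₑ ^ q.toReal ∂μ) l (𝓝 (∫⁻ _, 0 ∂μ)) := by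
    refine tendsto_lintegral_filter_of_dominated_convergence'
      (fun x => ‖bound x‖ₑ ^ q.toReal) ?_ ?_ ?_ ?_
    · filter_upwards [hm] with i hi
      exact hi.enorm.pow_const _
    · filter_upwards [hle] with i hi
      filter_upwards [hi] with x hx
      gcongr
      exact enorm_le_iff_norm_le.2 (hx.trans (le_abs_self _))
    · exact (lintegral_rpow_enorm_lt_top_of_eLpNorm_lt_top hq0 hq hbound.2).ne
    · filter_upwards [hlim] with x hx
      simpa [Function.comp_def, hqpos] using
        ((ENNReal.continuous_rpow_const (y := q.toReal)).tendsto _).comp hx.enorm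
  rw [lintegral_zero] at hint
  simp only [eLpNorm_eq_lintegral_rpow_enorm_toReal hq0 hq]
  simpa [Function.comp_def, hqpos] using
    ((ENNReal.continuous_rpow_const (y := 1 / q.toReal)).tendsto _).comp hint

end Lebesgue

section Sobolev

variable {n : ℕ}

theorem memLp_ball_of_continuous {F : Type*} [NormedAddCommGroup F] {f : Euc n → F}
    (hf : Continuous f) (q : ℝ≥0∞) : MemLp f q (volume.restrict (ball (0 : Euc n) 1)) := by
  obtain ⟨C, hC⟩ := (isCompact_closedBall (0 : Euc n) 1).exists_bound_of_continuousOn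
    hf.continuousOn
  have : IsFiniteMeasure (volume.restrict (ball (0 : Euc n) 1)) :=
    isFiniteMeasure_restrict.2 measure_ball_lt_top.ne
  refine MemLp.of_bound hf.aestronglyMeasurable C ?_
  filter_upwards [ae_restrict_mem measurableSet_ball] with x hx
  exact hC x (ball_subset_closedBall hx)

theorem hasH1Gradient_of_hasGradientAt {f : Euc n → ℝ} {X : Euc n → Euc n} (hX : Continuous X)
    (hf : ∀ x, HasGradientAt f (X x) x) : HasH1Gradient (ball (0 : Euc n) 1) f X := by
  have hfc : Continuous f := continuous_iff_continuousAt.2 fun x => (hf x).continuousAt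
  refine ⟨memLp_ball_of_continuous hfc 2, memLp_ball_of_continuous hX 2,
    fun φ hφ hcs hsupp v => ?_⟩
  have hφ' : Continuous (fderiv ℝ φ) := hφ.continuous_fderiv (by simp)
  have hzero : ∀ x ∉ ball (0 : Euc n) 1, φ x = 0 ∧ fderiv ℝ φ x = 0 := fun x hx =>
    ⟨image_eq_zero_of_notMem_tsupport fun h => hx (hsupp h),
      image_eq_zero_of_notMem_tsupport fun h => hx (hsupp (tsupport_fderiv_subset ℝ h))⟩
  have hcs' : HasCompactSupport fun x => fderiv ℝ φ x v :=
    (hcs.fderiv ℝ).comp_left (g := fun L : Euc n →L[ℝ] ℝ => L v) (by simp)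
  rw [setIntegral_eq_integral_of_forall_compl_eq_zero (fun x hx => by simp [(hzero x hx).2]),
    setIntegral_eq_integral_of_forall_compl_eq_zero (fun x hx => by simp [(hzero x hx).1])]
  simp only [← (hf _).fderiv_apply]
  refine integral_mul_fderiv_eq_neg_fderiv_mul_of_integrable ?_ ?_ ?_
    (fun x _ => (hf x).differentiableAt) fun x _ => (hφ.differentiable (by simp)) x
  · simp only [(hf _).fderiv_apply]
    exact Continuous.integrable_of_hasCompactSupport
      ((hX.inner continuous_const).mul hφ.continuous) hcs.mul_left
  · exact Continuous.integrable_of_hasCompactSupport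
      (hfc.mul (hφ'.clm_apply continuous_const)) hcs'.mul_left
  · exact Continuous.integrable_of_hasCompactSupport (hfc.mul hφ.continuous) hcs.mul_left

variable {ι : Type*} {l : Filter ι} {Ω : Set (Euc n)} {U : ι → Euc n → ℝ} {w w' : Euc n → ℝ}

theorem HasH1Gradient.congr_of_eqOn {X : Euc n → Euc n} (hw : HasH1Gradient Ω w X)
    (hΩ : MeasurableSet Ω) (heq : EqOn w w' Ω) : HasH1Gradient Ω w' X := by
  refine ⟨(memLp_congr_ae (heq.aeEq_restrict hΩ)).1 hw.memLp, hw.memLp_grad,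
    fun φ hφ hcs hsupp v => ?_⟩
  rw [← hw.weak φ hφ hcs hsupp v]
  exact setIntegral_congr_fun hΩ fun x hx => by simp only [heq hx]

theorem TendstoInH1.congr_right (hw : TendstoInH1 Ω l U w) (hΩ : MeasurableSet Ω)
    (heq : EqOn w w' Ω) : TendstoInH1 Ω l U w' := by
  obtain ⟨D, Dw, hDw, hD, hlim, hlimD⟩ := hw
  refine ⟨D, Dw, hDw.congr_of_eqOn hΩ heq, hD, hlim.congr fun i => ?_, hlimD⟩
  exact eLpNorm_congr_ae (ae_eq_rfl.sub (heq.aeEq_restrict hΩ))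

theorem TendstoInLinfty.congr_right (hw : TendstoInLinfty Ω l U w) (hΩ : MeasurableSet Ω)
    (heq : EqOn w w' Ω) : TendstoInLinfty Ω l U w' :=
  ⟨(memLp_congr_ae (heq.aeEq_restrict hΩ)).1 hw.1, hw.2.1,
    hw.2.2.congr fun _ => eLpNorm_congr_ae (ae_eq_rfl.sub (heq.aeEq_restrict hΩ))⟩

end Sobolev

section RadialConvergence

variable {n d : ℕ} {ι : Type*} {l : Filter ι} {u h : ι → ℝ → ℝ} {φ k : ℝ → ℝ}

theorem norm_mem_Ico_of_mem_ball {x : Euc n} (hx : x ∈ ball (0 : Euc n) 1) :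
    ‖x‖ ∈ Ico (0 : ℝ) 1 :=
  ⟨norm_nonneg _, mem_ball_zero_iff.1 hx⟩

theorem tendstoUniformlyOn_ball_comp_norm (hunif : TendstoUniformlyOn u φ l (Icc 0 1)) :
    TendstoUniformlyOn (fun i (x : Euc n) => u i ‖x‖) (fun x => φ ‖x‖) l (ball 0 1) :=
  (hunif.comp norm).mono fun _ hx => Ico_subset_Icc_self (norm_mem_Ico_of_mem_ball hx)

theorem HasRadialLaplacian.norm_radField_sub {u h φ k : ℝ → ℝ} (U : HasRadialLaplacian d u h)
    (Φ : HasRadialLaplacian d φ k) (x : Euc n) :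
    ‖radField d h x - radField d k x‖ = |deriv u ‖x‖ - deriv φ ‖x‖| := by
  rw [radField, radField, ← sub_smul, norm_smul, Real.norm_eq_abs, U.deriv_eq, Φ.deriv_eq,
    ← mul_sub, abs_mul, abs_norm, mul_comm]

theorem HasRadialLaplacian.hasH1Gradient_comp_norm {u h : ℝ → ℝ} (U : HasRadialLaplacian d u h) :
    HasH1Gradient (ball (0 : Euc n) 1) (fun x => u ‖x‖) (radField d h) :=
  hasH1Gradient_of_hasGradientAt (continuous_radField U.continuous_source)
    U.hasGradientAt_comp_norm

theorem tendstoInLinfty_comp_norm (hu : ∀ᶠ i in l, Continuous (u i)) (hφ : Continuous φ)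
    (hunif : TendstoUniformlyOn u φ l (Icc 0 1)) :
    TendstoInLinfty (ball (0 : Euc n) 1) l (fun i x => u i ‖x‖) fun x => φ ‖x‖ :=
  ⟨memLp_ball_of_continuous (hφ.comp continuous_norm) ∞,
    hu.mono fun _ hi => memLp_ball_of_continuous (hi.comp continuous_norm) ∞,
    tendsto_eLpNorm_sub_of_tendstoUniformlyOn measurableSet_ball measure_ball_lt_top.ne
      (tendstoUniformlyOn_ball_comp_norm hunif)⟩

theorem tendstoInH1_comp_norm [l.IsCountablyGenerated]
    (U : ∀ᶠ i in l, HasRadialLaplacian d (u i) (h i)) (Φ : HasRadialLaplacian d φ k)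
    (hunif : TendstoUniformlyOn u φ l (Icc 0 1))
    (hderiv : ∀ r ∈ Ico (0 : ℝ) 1, Tendsto (fun i => deriv (u i) r) l (𝓝 (deriv φ r))) {C : ℝ}
    (hC : ∀ᶠ i in l, ∀ r ∈ Icc (0 : ℝ) 1, |deriv (u i) r - deriv φ r| ≤ C) :
    TendstoInH1 (ball (0 : Euc n) 1) l (fun i x => u i ‖x‖) fun x => φ ‖x‖ := by
  refine ⟨fun i => radField d (h i), radField d k, Φ.hasH1Gradient_comp_norm,
    U.mono fun i hi => hi.hasH1Gradient_comp_norm,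
    tendsto_eLpNorm_sub_of_tendstoUniformlyOn measurableSet_ball measure_ball_lt_top.ne
      (tendstoUniformlyOn_ball_comp_norm hunif), ?_⟩
  refine tendsto_eLpNorm_zero_of_dominated (bound := fun _ => C) ENNReal.ofNat_ne_top ?_
    (memLp_ball_of_continuous continuous_const 2) ?_ ?_
  · filter_upwards [U] with i hi
    exact ((continuous_radField hi.continuous_source).sub
      (continuous_radField Φ.continuous_source)).aestronglyMeasurable
  · filter_upwards [U, hC] with i hi hCi
    filter_upwards [ae_restrict_mem measurableSet_ball] with x hx
    rw [Pi.sub_apply, hi.norm_radField_sub Φ]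
    exact hCi _ (Ico_subset_Icc_self (norm_mem_Ico_of_mem_ball hx))
  · filter_upwards [ae_restrict_mem measurableSet_ball] with x hx
    rw [tendsto_zero_iff_norm_tendsto_zero]
    refine (tendsto_iff_norm_sub_tendsto_zero.1
      (hderiv _ (norm_mem_Ico_of_mem_ball hx))).congr' ?_
    filter_upwards [U] with i hi
    rw [Pi.sub_apply, hi.norm_radField_sub Φ, Real.norm_eq_abs]

theorem IsRadialNeumannSolution.isNeumannSolution {V u h : ℝ → ℝ} {p : ℝ}
    (U : IsRadialNeumannSolution d V p u h) :
    IsNeumannSolution (d + 1) V p fun x => u ‖x‖ := by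
  refine ⟨U.contDiff_two_comp_norm.contDiffOn, fun x hx => ?_, fun x hx => ?_, fun x hx => ?_⟩
  · rw [U.laplacian_comp_norm finrank_euclideanSpace_fin,
      U.source _ (Ico_subset_Icc_self (norm_mem_Ico_of_mem_ball hx))]
    ring
  · exact U.pos _ (Ico_subset_Icc_self (norm_mem_Ico_of_mem_ball hx))
  · have hnorm : ‖x‖ = 1 := mem_sphere_zero_iff_norm.1 hx
    have hunique : UniqueDiffOn ℝ (closedBall (0 : Euc (d + 1)) 1) :=
      uniqueDiffOn_convex (convex_closedBall _ _)
        ⟨0, ball_subset_interior_closedBall (mem_ball_self one_pos)⟩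
    have havg : radAvg d h 1 = 0 := by rw [← one_mul (radAvg d h 1), ← U.deriv_eq, U.deriv_one]
    rw [(U.hasGradientAt_comp_norm x).hasFDerivAt.hasFDerivWithinAt.fderivWithin
      (hunique x (sphere_subset_closedBall hx)), radField, hnorm, havg, zero_smul, map_zero,
      zero_apply]

end RadialConvergence

theorem continuousOn_of_continuousOn_comp_norm {E F : Type*} [NormedAddCommGroup E]
    [NormedSpace ℝ E] [Nontrivial E] [TopologicalSpace F] {f : ℝ → F} {R : ℝ}
    (hf : ContinuousOn (fun x : E => f ‖x‖) (closedBall 0 R)) : ContinuousOn f (Icc 0 R) := by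
  obtain ⟨e, he⟩ := exists_norm_eq E zero_le_one
  have hnorm : ∀ r ∈ Icc (0 : ℝ) R, ‖r • e‖ = r := fun r hr => by
    rw [norm_smul, he, mul_one, Real.norm_of_nonneg hr.1]
  refine (hf.comp (f := fun r : ℝ => r • e) (by fun_prop) fun r hr => ?_).congr fun r hr => ?_
  · rw [mem_closedBall_zero_iff, hnorm r hr]
    exact hr.2
  · rw [Function.comp_apply, hnorm r hr]

theorem mainTheorem2_general (n : ℕ) (hn : 1 ≤ n) (V : ℝ → ℝ) (hV : ContinuousOn V (Icc 0 1))
    (hVnonneg : ∀ r ∈ Icc (0 : ℝ) 1, 0 ≤ V r)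
    (hVne : ∃ r ∈ Icc (0 : ℝ) 1, V r ≠ 0) :
    (∃ G : ℝ → ℝ → ℝ, IsNeumannGreen n V G) ∧
    ∀ G : ℝ → ℝ → ℝ, IsNeumannGreen n V G →
      (∀ r ∈ Ioc (0 : ℝ) 1, 0 < G r r) ∧
      (∃ ℓ : ℝ, ℓ < 0 ∧ Tendsto (deriv (energyF n G)) (𝓝[<] 1) (𝓝 ℓ)) ∧
      IsLocalMinOn (energyF n G) (Ioc 0 1) 1 ∧
      ∃ U : ℝ → ℝ → ℝ,
        (∀ᶠ p : ℝ in atTop, IsNeumannSolution n V p (fun x => U p ‖x‖)) ∧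
        TendstoInH1 (ball (0 : Euc n) 1) atTop (fun (p : ℝ) (x : Euc n) => U p ‖x‖)
          (fun x => G ‖x‖ 1 / G 1 1) ∧
        TendstoInLinfty (ball (0 : Euc n) 1) atTop (fun (p : ℝ) (x : Euc n) => U p ‖x‖)
          (fun x => G ‖x‖ 1 / G 1 1) := by
  obtain ⟨d, rfl⟩ := Nat.exists_eq_add_of_le' hn
  obtain ⟨φ, k, P⟩ := exists_isProfile d hV hVnonneg hVne
  obtain ⟨u, h, U, hunif, hderiv, C, hC⟩ := P.exists_isRadialNeumannSolution_family hV
  refine ⟨⟨_, P.isNeumannGreen_radialGreen hV⟩, fun G hG => ⟨fun r hr => hG.diag_pos P hr,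
    hG.exists_tendsto_deriv_energyF P, hG.isLocalMinOn_energyF P, u,
    U.mono fun p hp => hp.isNeumannSolution, ?_⟩⟩
  have heq : EqOn (fun x : Euc (d + 1) => φ ‖x‖) (fun x => G ‖x‖ 1 / G 1 1) (ball 0 1) :=
    fun x hx => (hG.apply_one_div P (Ico_subset_Icc_self (norm_mem_Ico_of_mem_ball hx))).symm
  have hH1 := tendstoInH1_comp_norm (n := d + 1) (U.mono fun p hp => hp.toHasRadialLaplacian)
    P.toHasRadialLaplacian hunif hderiv hC
  have hLinfty := tendstoInLinfty_comp_norm (n := d + 1) (U.mono fun p hp => hp.continuous)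
    P.continuous hunif
  exact ⟨hH1.congr_right measurableSet_ball heq, hLinfty.congr_right measurableSet_ball heq⟩

theorem mainTheorem2 (n : ℕ) (hn : 2 ≤ n) (V : ℝ → ℝ)
    (hVsmooth : ContDiffOn ℝ ∞ (fun x : Euc n => V ‖x‖) (closedBall 0 1))
    (hVnonneg : ∀ r ∈ Icc (0 : ℝ) 1, 0 ≤ V r)
    (hVne : ∃ r ∈ Icc (0 : ℝ) 1, V r ≠ 0) :
    (∃ G : ℝ → ℝ → ℝ, IsNeumannGreen n V G) ∧
    ∀ G : ℝ → ℝ → ℝ, IsNeumannGreen n V G →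
      (∀ r ∈ Ioc (0 : ℝ) 1, 0 < G r r) ∧
      (∃ ℓ : ℝ, ℓ < 0 ∧ Tendsto (deriv (energyF n G)) (𝓝[<] 1) (𝓝 ℓ)) ∧
      IsLocalMinOn (energyF n G) (Ioc 0 1) 1 ∧
      ∃ U : ℝ → ℝ → ℝ,
        (∀ᶠ p : ℝ in atTop, IsNeumannSolution n V p (fun x => U p ‖x‖)) ∧
        TendstoInH1 (ball (0 : Euc n) 1) atTop (fun (p : ℝ) (x : Euc n) => U p ‖x‖)
          (fun x => G ‖x‖ 1 / G 1 1) ∧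
        TendstoInLinfty (ball (0 : Euc n) 1) atTop (fun (p : ℝ) (x : Euc n) => U p ‖x‖)
          (fun x => G ‖x‖ 1 / G 1 1) :=
  have : Nontrivial (Fin n) := Fin.nontrivial_iff_two_le.2 hn
  mainTheorem2_general n (one_le_two.trans hn) V
    (continuousOn_of_continuousOn_comp_norm hVsmooth.continuousOn) hVnonneg hVne
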